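/- For $\sigma=\sigma_1\cdots\sigma_{2n}\in\mathfrak S_{2n}$ (written as a word in the letters $1,\dots,2n$; for $n=0$ there is only the empty word), a descent is a pair $(\sigma_{i-1},\sigma_i)$ with $\sigma_{i-1}>\sigma_i$; then $\sigma_{i-1}$ is a descent top and $\sigma_i$ a descent bottom, and $\mathrm{des}\,\sigma$ is the number of descents. For a letter $x$ of $\sigma$, let $l_\sigma(x)$ (resp. $r_\sigma(x)$) be the number of descents $(\sigma_{i-1},\sigma_i)$ with $\sigma_{i-1}>x>\sigma_i$ that lie to the left (resp. to the right) of $x$ in $\sigma$, and put $\mathrm{les}\,\sigma=\sum_x l_\sigma(x)$, $\mathrm{res}\,\sigma=\sum_x r_\sigma(x)$. An E-permutation of $[2n]$ is a $\sigma\in\mathfrak S_{2n}$ all of whose descents have an even top and an odd bottom, and such that for no $j\in[n]$ both $2j-1$ is a descent bottom and $2j$ is a descent top. Let $S_\sigma$ be the set of descent tops and descent bottoms of $\sigma$, and let $s(x)=\#\{y\in S_\sigma: y<x,\ y\text{ odd}\}-\#\{y\in S_\sigma: y<x,\ y\text{ even}\}+\varepsilon(x)$, where $\varepsilon(x)=1$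 if $x\notin S_\sigma$ or $x$ is odd, and $\varepsilon(x)=0$ otherwise. An E-permutation $\sigma$ is normalized if for every $j\in[n]$: (a) if $2j-1\in S_\sigma$ and $s(2j-1)$ is odd, then $l_\sigma(2j)$ is even; (b) if $2j-1\in S_\sigma$ and $s(2j-1)$ is even, then $l_\sigma(2j-1)$ is even; (c) if $2j\in S_\sigma$ and $s(2j)$ is odd, then $r_\sigma(2j-1)$ is even; (d) if $2j\in S_\sigma$ and $s(2j)$ is even, then $r_\sigma(2j)$ is even. Let $\widehat{\mathcal X}_{2n}$ be the set of normalized E-permutations of $[2n]$. Let $[n]_{p,q}=\sum_{i=0}^{n-1}p^{n-1-i}q^i$ and $\binom{n+1}{2}_{p,q}=\dfrac{[n+1]_{p,q}[n]_{p,q}}{[1]_{p,q}[2]_{p,q}}$. Let $H_{2n+1}$ ($n\ge 0$) be the median Genocchi numbers $1,2,8,56,608,\dots$, that is, the leftmost entries of the even rows of the Seidel triangle, whose first row is $1$, in which row $2k+2$ is formed by the right-to-left partial sums of row $2k+1$, and row $2k+3$ by the left-to-right partial sums of row $2k+2$ with the last sum repeated once. **Corollary.** Every $\sigma\in\widehat{\mathcal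 X}_{2n}$ satisfies $\mathrm{res}\,\sigma\ge\mathrm{des}\,\sigma$ and $\mathrm{les}\,\sigma\ge\mathrm{des}\,\sigma$. For all elements $p,q,t$ of a field with $p+q\ne 0$ (in particular for indeterminates over $\mathbb Q$), as formal power series in $x$, $$\sum_{n\ge 0}\ \sum_{\sigma\in\widehat{\mathcal X}_{2n}}p^{\mathrm{res}\,\sigma-\mathrm{des}\,\sigma}\,q^{\mathrm{les}\,\sigma-\mathrm{des}\,\sigma}\,t^{\mathrm{des}\,\sigma}\,x^n=\cfrac{1}{1-b_0x-\cfrac{\lambda_1x^2}{1-b_1x-\cfrac{\lambda_2x^2}{1-b_2x-\cdots}}}$$ with $b_{n-1}=[n]_{p,q}^2$ and $\lambda_n=\binom{n+1}{2}_{p,q}^2\,t$ for $n\ge 1$. Hence $|\widehat{\mathcal X}_{2n}|=H_{2n+1}/2^n$ for all $n\ge 0$. -/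

import Mathlib

open Finset

namespace EvenOdd

/-! ### Permutations of `[N]` as words `σ₁ σ₂ … σ_N` with letters `1, …, N` -/

/-- The letter `σ_i` of `σ` in position `i ∈ {1, …, N}` (and `0` for a position outside this range).
`Fin N` is `{0, …, N - 1}`, so positions and letters are shifted by one. -/
def letter {N : ℕ} (σ : Equiv.Perm (Fin N)) (i : ℕ) : ℕ :=
  if h : 1 ≤ i ∧ i ≤ N then (σ ⟨i - 1, by omega⟩ : ℕ) + 1 else 0

/-- The pair of adjacent letters `(σ_{i-1}, σ_i)`, with `2 ≤ i ≤ N`, is a descent. -/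
def IsDescentAt {N : ℕ} (σ : Equiv.Perm (Fin N)) (i : ℕ) : Prop :=
  2 ≤ i ∧ i ≤ N ∧ letter σ i < letter σ (i - 1)

instance {N : ℕ} (σ : Equiv.Perm (Fin N)) (i : ℕ) : Decidable (IsDescentAt σ i) := by
  unfold IsDescentAt; infer_instance

/-- The number of descents. -/
def des {N : ℕ} (σ : Equiv.Perm (Fin N)) : ℕ :=
  #{i ∈ Icc 1 N | IsDescentAt σ i}

/-- The number of pairs `(i, j)` with `2 ≤ i < j ≤ N` and `σ_{i-1} > σ_j > σ_i`. -/
def les {N : ℕ} (σ : Equiv.Perm (Fin N)) : ℕ :=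
  #{ij ∈ Icc 1 N ×ˢ Icc 1 N | 2 ≤ ij.1 ∧ ij.1 < ij.2 ∧
    letter σ (ij.1 - 1) > letter σ ij.2 ∧ letter σ ij.2 > letter σ ij.1}

/-- The number of pairs `(i, j)` with `1 ≤ i < j ≤ N - 1` and `σ_j > σ_i > σ_{j+1}`. -/
def res {N : ℕ} (σ : Equiv.Perm (Fin N)) : ℕ :=
  #{ij ∈ Icc 1 N ×ˢ Icc 1 N | ij.1 < ij.2 ∧ ij.2 + 1 ≤ N ∧
    letter σ ij.2 > letter σ ij.1 ∧ letter σ ij.1 > letter σ (ij.2 + 1)}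

/-- `l_σ(x)`: the number of left-embracings of the letter `x = σ_j`, that is, of descents
`(σ_{i-1}, σ_i)` with `i < j` and `σ_{i-1} > x > σ_i`. -/
def leftEmb {N : ℕ} (σ : Equiv.Perm (Fin N)) (x : ℕ) : ℕ :=
  #{ij ∈ Icc 1 N ×ˢ Icc 1 N | letter σ ij.2 = x ∧ 2 ≤ ij.1 ∧ ij.1 < ij.2 ∧
    letter σ (ij.1 - 1) > x ∧ x > letter σ ij.1}

/-- `r_σ(x)`: the number of right-embracings of the letter `x = σ_i`, that is, of descents
`(σ_j, σ_{j+1})` with `i < j` and `σ_j > x > σ_{j+1}`. -/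
def rightEmb {N : ℕ} (σ : Equiv.Perm (Fin N)) (x : ℕ) : ℕ :=
  #{ij ∈ Icc 1 N ×ˢ Icc 1 N | letter σ ij.1 = x ∧ ij.1 < ij.2 ∧ ij.2 + 1 ≤ N ∧
    letter σ ij.2 > x ∧ x > letter σ (ij.2 + 1)}

/-- The set of descent tops. -/
def descentTops {N : ℕ} (σ : Equiv.Perm (Fin N)) : Finset ℕ :=
  {i ∈ Icc 1 N | IsDescentAt σ i}.image fun i => letter σ (i - 1)

/-- The set of descent bottoms. -/
def descentBottoms {N : ℕ} (σ : Equiv.Perm (Fin N)) : Finset ℕ :=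
  {i ∈ Icc 1 N | IsDescentAt σ i}.image fun i => letter σ i

/-- `S_σ`: the set of descent tops and descent bottoms. -/
def signature {N : ℕ} (σ : Equiv.Perm (Fin N)) : Finset ℕ :=
  descentTops σ ∪ descentBottoms σ

/-- The signature function
`s(x) = S_o(x) - S_e(x) + (1 if x ∈ S is odd or x ∉ S)`,
where `S_o(x)` and `S_e(x)` are the numbers of odd and even elements of `S` less than `x`. -/
def sigFun (S : Finset ℕ) (x : ℕ) : ℤ :=
  (#{y ∈ S | Odd y ∧ y < x} : ℤ) - (#{y ∈ S | Even y ∧ y < x} : ℤ) +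
    (if (x ∈ S ∧ Odd x) ∨ x ∉ S then 1 else 0)

/-! ### Even-odd descent permutations, E-permutations, normalized E-permutations -/

/-- Every descent `(σ_{i-1}, σ_i)` has `σ_{i-1}` even and `σ_i` odd. -/
def IsEvenOdd {n : ℕ} (σ : Equiv.Perm (Fin (2 * n))) : Prop :=
  ∀ i ∈ Icc 1 (2 * n), IsDescentAt σ i → Even (letter σ (i - 1)) ∧ Odd (letter σ i)

/-- An even-odd descent permutation for which there is no `j ∈ [n]` such that `2j - 1` is a descent
bottom and `2j` is a descent top. -/
def IsEPerm {n : ℕ} (σ : Equiv.Perm (Fin (2 * n))) : Prop :=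
  IsEvenOdd σ ∧ ∀ j ∈ Icc 1 n, ¬ (2 * j - 1 ∈ descentBottoms σ ∧ 2 * j ∈ descentTops σ)

/-- Normalized E-permutations. -/
def IsNormalized {n : ℕ} (σ : Equiv.Perm (Fin (2 * n))) : Prop :=
  IsEPerm σ ∧ ∀ j ∈ Icc 1 n,
    (2 * j - 1 ∈ signature σ → Odd (sigFun (signature σ) (2 * j - 1)) →
      Even (leftEmb σ (2 * j))) ∧
    (2 * j - 1 ∈ signature σ → Even (sigFun (signature σ) (2 * j - 1)) →
      Even (leftEmb σ (2 * j - 1))) ∧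
    (2 * j ∈ signature σ → Odd (sigFun (signature σ) (2 * j)) →
      Even (rightEmb σ (2 * j - 1))) ∧
    (2 * j ∈ signature σ → Even (sigFun (signature σ) (2 * j)) →
      Even (rightEmb σ (2 * j)))

instance {n : ℕ} (σ : Equiv.Perm (Fin (2 * n))) : Decidable (IsNormalized σ) := by
  unfold IsNormalized IsEPerm IsEvenOdd; infer_instance

/-- The set of normalized E-permutations of `[2n]`. -/
def normalizedEPerms (n : ℕ) : Finset (Equiv.Perm (Fin (2 * n))) :=
  {σ | IsNormalized σ}

/-! ### `(p, q)`-analogues -/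

/-- `[n]_{p,q} = p^{n-1} + p^{n-2} q + ⋯ + q^{n-1}`. -/
def pqNat {R : Type*} [CommSemiring R] (p q : R) (n : ℕ) : R :=
  ∑ i ∈ range n, p ^ (n - 1 - i) * q ^ i

/-- `[n]_{p,q} ⋯ [n-k+1]_{p,q} / ([1]_{p,q} ⋯ [k]_{p,q})`, for `k ≤ n`. -/
noncomputable def pqBinom {K : Type*} [Field K] (p q : K) (n k : ℕ) : K :=
  (∏ i ∈ range k, pqNat p q (n - i)) / ∏ i ∈ range k, pqNat p q (i + 1)

/-! ### J-fractions as formal power series -/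

/-- The finite continued fraction
`1 / (1 - b_k x - λ_{k+1} x² / (1 - b_{k+1} x - λ_{k+2} x² / ( ⋯ / (1 - b_{k+m-1} x))))`
with `m` levels, a formal power series in `x` (and `0` for `m = 0`). -/
noncomputable def jConvergent {K : Type*} [Field K] (b lam : ℕ → K) :
    ℕ → ℕ → PowerSeries K
  | 0, _ => 0
  | m + 1, k => (1 - PowerSeries.C (b k) * PowerSeries.X -
      PowerSeries.C (lam (k + 1)) * PowerSeries.X ^ 2 * jConvergent b lam m (k + 1))⁻¹

/-- `F` is the value of the infinite J-fraction
`1 / (1 - b₀ x - λ₁ x² / (1 - b₁ x - λ₂ x² / ( ⋯ )))`: the convergents tend to `F` in the ring of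
formal power series, that is, each coefficient is eventually equal to that of `F`. -/
def HasJFraction {K : Type*} [Field K] (F : PowerSeries K) (b lam : ℕ → K) : Prop :=
  ∀ n : ℕ, ∀ᶠ m in Filter.atTop,
    PowerSeries.coeff n (jConvergent b lam m 0) = PowerSeries.coeff n F

/-! ### Median Genocchi numbers through the Seidel triangle -/

/-- The row of the Seidel triangle that is obtained from a row `u₀, …, u_k` by summing from right
to left: its entry in column `j` is `u_j + u_{j+1} + ⋯ + u_k`. -/
def seidelBack (k : ℕ) (u : ℕ → ℕ) (j : ℕ) : ℕ := ∑ i ∈ Icc j k, u i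

/-- The row `2k + 1` of the Seidel triangle, with entries in the columns `0, …, k`. Row `1` is `1`,
row `2k + 2` is obtained from row `2k + 1` by summing from right to left, and row `2k + 3` from row
`2k + 2` by summing from left to right, with the last sum written twice. -/
def seidelOddRow : ℕ → ℕ → ℕ
  | 0 => fun j => if j = 0 then 1 else 0
  | k + 1 => fun j => ∑ i ∈ range (j + 1), seidelBack k (seidelOddRow k) i

/-- The median Genocchi number `H_{2n+1}`, the leftmost entry of row `2n + 2` of the Seidel
triangle: `1, 2, 8, 56, 608, …` for `n = 0, 1, 2, 3, 4, …`. -/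
def medianGenocchi (n : ℕ) : ℕ := seidelBack n (seidelOddRow n) 0

end EvenOdd

/-!
A permutation is determined by its Laguerre history, which records for each letter, in increasing
order, whether it is a descent top, whether it is a descent bottom, and its number of left
embracings: the descents that cross the level `x` cut the word into blocks, and the number of left
embracings of `x` tells in which gap between the smaller letters `x` is inserted, so the history
reconstructs the relative order of the letters `1, …, x` one letter at a time. Since there are `N!`
histories of length `N`, every history occurs.

The conditions on a normalized E-permutation are local: for each `j` they only involve the steps of
`2j - 1` and `2j` and the height between them. Summing over the steps of each pair therefore turns
the generating function into that of weighted Motzkin paths, with weight `[h + 1]²` for a level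
step at height `h`, `[h + 1] [h + 2] t / (p + q)` for an up step from `h`, and
`[h + 1] [h] / (p + q)` for a down step from `h`. This is the J-fraction of the theorem.

For the median Genocchi numbers, let `c_m = ∏_{j < m} (j (j + 1) - X (X + 1))` and let `φ` be the
linear functional on polynomials with `φ(c_m) = m! (m + 1)!` and `φ((X + 1) c_m) = 0`. The numbers
`(-1)^n φ(X^{n + j} (X + 1)^{n - j})` satisfy the recurrences of the Seidel triangle, so that
`H_{2n+1} = φ((-X (X + 1))^n)`. Expanding in the `c_m` shows that these moments are the Motzkin sums
above for `p = q = t = 1`, multiplied by `2^n`.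
-/

namespace EvenOdd

section FinsetSums

variable {ι κ M : Type*}

lemma sum_range_two_mul [AddCommMonoid M] (f : ℕ → M) (n : ℕ) :
    ∑ i ∈ range (2 * n), f i = ∑ i ∈ range n, (f (2 * i) + f (2 * i + 1)) := by
  induction n with
  | zero => rfl
  | succ n ih => rw [mul_add_one, sum_range_succ, sum_range_succ, ih, sum_range_succ, add_assoc]

lemma sum_Icc_one_two_mul [AddCommMonoid M] (f : ℕ → M) (n : ℕ) :
    ∑ i ∈ Icc 1 (2 * n), f i = ∑ j ∈ Icc 1 n, (f (2 * j - 1) + f (2 * j)) := by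
  simp only [← Ico_add_one_right_eq_Icc, sum_Ico_eq_sum_range, Nat.add_sub_cancel,
    sum_range_two_mul]
  refine sum_congr rfl fun i _ => ?_
  congr 2 <;> omega

lemma card_filter_eq_ite_of_injOn [DecidableEq κ] {s : Finset ι} {f : ι → κ}
    (hf : Set.InjOn f s) (k : κ) :
    #{i ∈ s | f i = k} = if k ∈ s.image f then 1 else 0 := by
  split_ifs with hk
  · obtain ⟨i, hi, rfl⟩ := mem_image.1 hk
    refine card_eq_one.2 ⟨i, ext fun j => ?_⟩
    simp only [mem_filter, mem_singleton]
    refine ⟨fun hj => hf hj.1 hi hj.2, ?_⟩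
    rintro rfl
    exact ⟨hi, rfl⟩
  · refine card_eq_zero.2 (filter_eq_empty_iff.2 fun i hi hik => hk ?_)
    exact mem_image.2 ⟨i, hi, hik⟩

end FinsetSums

/-! ### Words -/

section Words

variable {N : ℕ} (σ : Equiv.Perm (Fin N)) {i x : ℕ}

/-- The position of the letter `x` in the word `σ` (and `0` if `x` is not in `{1, …, N}`). -/
def pos (x : ℕ) : ℕ := letter σ⁻¹ x

lemma letter_bounds (hi : 1 ≤ i ∧ i ≤ N) : 1 ≤ letter σ i ∧ letter σ i ≤ N := by
  rw [letter, dif_pos hi]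
  omega

lemma pos_bounds (hx : 1 ≤ x ∧ x ≤ N) : 1 ≤ pos σ x ∧ pos σ x ≤ N :=
  letter_bounds σ⁻¹ hx

lemma letter_inv_letter (hi : 1 ≤ i ∧ i ≤ N) : letter σ⁻¹ (letter σ i) = i := by
  rw [letter, dif_pos (letter_bounds σ hi)]
  simp only [letter, dif_pos hi, Nat.add_sub_cancel, Fin.eta, Equiv.Perm.coe_inv,
    Equiv.symm_apply_apply]
  omega

lemma pos_letter (hi : 1 ≤ i ∧ i ≤ N) : pos σ (letter σ i) = i :=
  letter_inv_letter σ hi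

lemma letter_pos (hx : 1 ≤ x ∧ x ≤ N) : letter σ (pos σ x) = x := by
  simpa only [pos, inv_inv] using letter_inv_letter σ⁻¹ hx

lemma letter_eq_iff (hi : 1 ≤ i ∧ i ≤ N) (hx : 1 ≤ x ∧ x ≤ N) :
    letter σ i = x ↔ i = pos σ x :=
  ⟨fun h => h ▸ (pos_letter σ hi).symm, fun h => h ▸ letter_pos σ hx⟩

lemma injOn_letter : Set.InjOn (letter σ) (Icc 1 N) := fun i hi j hj h => by
  rw [coe_Icc] at hi hj
  rw [← pos_letter σ hi, h, pos_letter σ hj]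

lemma injOn_pos : Set.InjOn (pos σ) (Icc 1 N) := injOn_letter σ⁻¹

/-- The positions `i` of the descents `(σ_{i-1}, σ_i)`. -/
def descents : Finset ℕ := {i ∈ Icc 1 N | IsDescentAt σ i}

lemma mem_descents : i ∈ descents σ ↔ (2 ≤ i ∧ i ≤ N) ∧ letter σ i < letter σ (i - 1) := by
  rw [descents, mem_filter, mem_Icc, IsDescentAt]
  omega

lemma injOn_letter_descents : Set.InjOn (letter σ) (descents σ) :=
  (injOn_letter σ).mono (coe_subset.2 (filter_subset _ _))

lemma injOn_letter_pred_descents : Set.InjOn (fun i => letter σ (i - 1)) (descents σ) := by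
  intro i hi j hj h
  rw [mem_coe, mem_descents] at hi hj
  have : i - 1 = j - 1 := injOn_letter σ (by simp; omega) (by simp; omega) h
  omega

lemma mem_descentBottoms : x ∈ descentBottoms σ ↔ ∃ i ∈ descents σ, letter σ i = x :=
  mem_image

lemma mem_descentTops : x ∈ descentTops σ ↔ ∃ i ∈ descents σ, letter σ (i - 1) = x :=
  mem_image

lemma descentBottoms_subset : descentBottoms σ ⊆ Icc 1 N := by
  intro x hx
  obtain ⟨i, hi, rfl⟩ := (mem_descentBottoms σ).1 hx
  rw [mem_descents] at hi
  exact mem_Icc.2 (letter_bounds σ (by omega))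

lemma descentTops_subset : descentTops σ ⊆ Icc 1 N := by
  intro x hx
  obtain ⟨i, hi, rfl⟩ := (mem_descentTops σ).1 hx
  rw [mem_descents] at hi
  exact mem_Icc.2 (letter_bounds σ (by omega))

lemma mem_descentBottoms_iff_pos (hx : 1 ≤ x ∧ x ≤ N) :
    x ∈ descentBottoms σ ↔ pos σ x ∈ descents σ := by
  rw [mem_descentBottoms]
  refine ⟨?_, fun h => ⟨_, h, letter_pos σ hx⟩⟩
  rintro ⟨i, hi, rfl⟩
  rwa [pos_letter σ (by rw [mem_descents] at hi; omega)]

lemma mem_descentTops_iff_pos (hx : 1 ≤ x ∧ x ≤ N) :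
    x ∈ descentTops σ ↔ pos σ x + 1 ∈ descents σ := by
  rw [mem_descentTops]
  refine ⟨?_, fun h => ⟨_, h, letter_pos σ hx⟩⟩
  rintro ⟨i, hi, rfl⟩
  have hi2 := (mem_descents σ).1 hi
  rwa [pos_letter σ (by omega), Nat.sub_add_cancel (by omega)]

lemma des_eq_sum_descentBottoms :
    des σ = ∑ x ∈ Icc 1 N, if x ∈ descentBottoms σ then 1 else 0 := by
  rw [sum_boole, filter_mem_eq_inter, inter_eq_right.2 (descentBottoms_subset σ)]
  exact (card_image_of_injOn (injOn_letter_descents σ)).symm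

lemma des_eq_sum_descentTops :
    des σ = ∑ x ∈ Icc 1 N, if x ∈ descentTops σ then 1 else 0 := by
  rw [sum_boole, filter_mem_eq_inter, inter_eq_right.2 (descentTops_subset σ)]
  exact (card_image_of_injOn (injOn_letter_pred_descents σ)).symm

/-- The positions `i` of the descents `(σ_{i-1}, σ_i)` with `σ_i < x ≤ σ_{i-1}`. -/
def crossings (x : ℕ) : Finset ℕ :=
  {i ∈ descents σ | letter σ i < x ∧ x ≤ letter σ (i - 1)}

/-- The positions `i` of the descents `(σ_{i-1}, σ_i)` with `σ_i < x < σ_{i-1}`. -/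
def embracings (x : ℕ) : Finset ℕ :=
  {i ∈ descents σ | letter σ i < x ∧ x < letter σ (i - 1)}

/-- The number of descents that cross the level `x`. It is the height, before the step of the letter
`x`, of the Motzkin path of `σ`. -/
def height (x : ℕ) : ℕ := #(crossings σ x)

lemma mem_crossings :
    i ∈ crossings σ x ↔ (2 ≤ i ∧ i ≤ N) ∧ letter σ i < x ∧ x ≤ letter σ (i - 1) := by
  rw [crossings, mem_filter, mem_descents]
  omega

lemma mem_embracings :
    i ∈ embracings σ x ↔ (2 ≤ i ∧ i ≤ N) ∧ letter σ i < x ∧ x < letter σ (i - 1) := by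
  rw [embracings, mem_filter, mem_descents]
  omega

lemma height_one : height σ 1 = 0 := by
  refine card_eq_zero.2 (eq_empty_of_forall_notMem fun i hi => ?_)
  rw [mem_crossings] at hi
  have := letter_bounds σ (i := i) (by omega)
  omega

lemma height_last : height σ (N + 1) = 0 := by
  refine card_eq_zero.2 (eq_empty_of_forall_notMem fun i hi => ?_)
  rw [mem_crossings] at hi
  have := letter_bounds σ (i := i - 1) (by omega)
  omega

lemma height_eq_card_embracings_add (x : ℕ) :
    height σ x = #(embracings σ x) + if x ∈ descentTops σ then 1 else 0 := by
  rw [descentTops, ← descents, ← card_filter_eq_ite_of_injOn (injOn_letter_pred_descents σ),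
    embracings, ← card_union_of_disjoint (disjoint_filter.2 fun _ _ _ => by omega), ← filter_or,
    height, crossings]
  refine congrArg card (filter_congr fun i hi => ?_)
  rw [mem_descents] at hi
  omega

lemma height_succ_eq_card_embracings_add (x : ℕ) :
    height σ (x + 1) = #(embracings σ x) + if x ∈ descentBottoms σ then 1 else 0 := by
  rw [descentBottoms, ← descents, ← card_filter_eq_ite_of_injOn (injOn_letter_descents σ),
    embracings, ← card_union_of_disjoint (disjoint_filter.2 fun _ _ _ => by omega), ← filter_or,
    height, crossings]
  refine congrArg card (filter_congr fun i hi => ?_)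
  rw [mem_descents] at hi
  omega

lemma height_add_card_descentTops_lt (x : ℕ) :
    height σ x + #{y ∈ descentTops σ | y < x} = #{y ∈ descentBottoms σ | y < x} := by
  have card_bottoms : #{y ∈ descentBottoms σ | y < x} = #{i ∈ descents σ | letter σ i < x} := by
    rw [descentBottoms, ← descents, filter_image, card_image_of_injOn]
    exact (injOn_letter_descents σ).mono (coe_subset.2 (filter_subset _ _))
  have card_tops : #{y ∈ descentTops σ | y < x} = #{i ∈ descents σ | letter σ (i - 1) < x} := by
    rw [descentTops, ← descents, filter_image, card_image_of_injOn]
    exact (injOn_letter_pred_descents σ).mono (coe_subset.2 (filter_subset _ _))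
  rw [card_bottoms, card_tops, height, crossings,
    ← card_union_of_disjoint (disjoint_filter.2 fun _ _ _ => by omega), ← filter_or]
  refine congrArg card (filter_congr fun i hi => ?_)
  rw [mem_descents] at hi
  omega

lemma leftEmb_eq_card_embracings (hx : 1 ≤ x ∧ x ≤ N) :
    leftEmb σ x = #{i ∈ embracings σ x | i < pos σ x} := by
  have hp := pos_bounds σ hx
  refine card_nbij' (fun ij => ij.1) (fun i => (i, pos σ x)) ?_ ?_ ?_ fun _ _ => rfl
  · rintro ⟨i, j⟩ h
    simp only [coe_filter, mem_product, mem_Icc, Set.mem_ofPred_eq, mem_embracings] at h ⊢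
    have := (letter_eq_iff σ h.1.2 hx).1 h.2.1
    omega
  · intro i h
    simp only [coe_filter, mem_product, mem_Icc, Set.mem_ofPred_eq, mem_embracings] at h ⊢
    exact ⟨by omega, letter_pos σ hx, by omega⟩
  · rintro ⟨i, j⟩ h
    simp only [coe_filter, mem_product, mem_Icc, Set.mem_ofPred_eq] at h
    rw [(letter_eq_iff σ h.1.2 hx).1 h.2.1]

lemma rightEmb_eq_card_embracings (hx : 1 ≤ x ∧ x ≤ N) :
    rightEmb σ x = #{i ∈ embracings σ x | pos σ x < i} := by
  have hp := pos_bounds σ hx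
  have hl := letter_pos σ hx
  refine card_nbij' (fun ij => ij.2 + 1) (fun i => (pos σ x, i - 1)) ?_ ?_ ?_ ?_
  · rintro ⟨i, j⟩ h
    simp only [coe_filter, mem_product, mem_Icc, Set.mem_ofPred_eq, mem_embracings] at h ⊢
    have := (letter_eq_iff σ h.1.1 hx).1 h.2.1
    simp only [Nat.add_sub_cancel]
    omega
  · intro i h
    simp only [coe_filter, mem_product, mem_Icc, Set.mem_ofPred_eq, mem_embracings] at h ⊢
    have hne : i - 1 ≠ pos σ x := fun hi => by rw [hi] at h; omega
    rw [Nat.sub_add_cancel (by omega)]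
    exact ⟨by omega, hl, by omega⟩
  · rintro ⟨i, j⟩ h
    simp only [coe_filter, mem_product, mem_Icc, Set.mem_ofPred_eq] at h
    simp only [(letter_eq_iff σ h.1.1 hx).1 h.2.1, Nat.add_sub_cancel]
  · intro i h
    exact Nat.sub_add_cancel (by simp only [coe_filter, Set.mem_ofPred_eq] at h; omega)

lemma leftEmb_add_rightEmb (hx : 1 ≤ x ∧ x ≤ N) :
    leftEmb σ x + rightEmb σ x = #(embracings σ x) := by
  rw [leftEmb_eq_card_embracings σ hx, rightEmb_eq_card_embracings σ hx,
    ← card_union_of_disjoint (disjoint_filter.2 fun _ _ _ => by omega), ← filter_or,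
    filter_true_of_mem fun i hi => ?_]
  have hne : i ≠ pos σ x := by
    rintro rfl
    rw [mem_embracings, letter_pos σ hx] at hi
    omega
  omega

lemma leftEmb_eq_card_crossings (hx : 1 ≤ x ∧ x ≤ N) :
    leftEmb σ x = #{i ∈ crossings σ x | i < pos σ x} := by
  rw [leftEmb_eq_card_embracings σ hx]
  refine congrArg card (ext fun i => ?_)
  simp only [mem_filter, mem_crossings, mem_embracings]
  have hlt : 2 ≤ i ∧ i ≤ N → i < pos σ x → letter σ (i - 1) ≠ x := fun hi hlt h => by
    have := (letter_eq_iff σ (by omega) hx).1 h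
    omega
  omega

lemma les_eq_sum_leftEmb : les σ = ∑ x ∈ Icc 1 N, leftEmb σ x := by
  rw [les, card_eq_sum_card_fiberwise (f := fun ij => letter σ ij.2) (t := Icc 1 N)]
  · refine sum_congr rfl fun x _ => congrArg card ?_
    rw [filter_filter]
    refine filter_congr fun ij _ => ?_
    omega
  · intro ij h
    simp only [coe_filter, mem_product, mem_Icc, Set.mem_ofPred_eq] at h
    exact mem_coe.2 (mem_Icc.2 (letter_bounds σ h.1.2))

lemma res_eq_sum_rightEmb : res σ = ∑ x ∈ Icc 1 N, rightEmb σ x := by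
  rw [res, card_eq_sum_card_fiberwise (f := fun ij => letter σ ij.1) (t := Icc 1 N)]
  · refine sum_congr rfl fun x _ => congrArg card ?_
    rw [filter_filter]
    refine filter_congr fun ij _ => ?_
    omega
  · intro ij h
    simp only [coe_filter, mem_product, mem_Icc, Set.mem_ofPred_eq] at h
    exact mem_coe.2 (mem_Icc.2 (letter_bounds σ h.1.1))

end Words

/-! ### Laguerre histories -/

/-- A step of a Laguerre history: whether a letter is a descent top, whether it is a descent bottom,
and the number of its left embracings. -/
structure Step where
  isTop : Bool
  isBottom : Bool
  left : ℕ
deriving DecidableEq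

section Injectivity

variable {N : ℕ} (σ τ : Equiv.Perm (Fin N)) {a b c i j x : ℕ}

/-- The step of the letter `x` in the Laguerre history of `σ`. -/
def step (x : ℕ) : Step where
  isTop := decide (x ∈ descentTops σ)
  isBottom := decide (x ∈ descentBottoms σ)
  left := leftEmb σ x

/-- The Laguerre history of `σ`: the list of the steps of the letters `1, …, N`. -/
def code : List Step := (List.range' 1 N).map (step σ)

lemma exists_crossing (hi : 1 ≤ i) (hij : i < j) (hj : j ≤ N)
    (hxi : x ≤ letter σ i) (hjx : letter σ j < x) : ∃ k ∈ crossings σ x, i < k ∧ k ≤ j := by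
  induction j, hij using Nat.le_induction with
  | base => exact ⟨i + 1, (mem_crossings σ).2 ⟨by omega, hjx, hxi⟩, by omega, le_rfl⟩
  | succ j hij ih =>
    rcases lt_or_ge (letter σ j) x with h | h
    · obtain ⟨k, hk, hik, hkj⟩ := ih (by omega) h
      exact ⟨k, hk, hik, by omega⟩
    · exact ⟨j + 1, (mem_crossings σ).2 ⟨by omega, hjx, h⟩, by omega, le_rfl⟩

lemma pos_lt_pos_iff_card_crossings_le (ha : 1 ≤ a) (hax : a < x) (hx : x ≤ N) :
    pos σ a < pos σ x ↔ #{i ∈ crossings σ x | i ≤ pos σ a} ≤ leftEmb σ x := by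
  have hxN : 1 ≤ x ∧ x ≤ N := by omega
  have haN : 1 ≤ a ∧ a ≤ N := by omega
  rw [leftEmb_eq_card_crossings σ hxN]
  refine ⟨fun hlt => card_le_card (monotone_filter_right _ fun i _ hi => hi.trans_lt hlt), ?_⟩
  -- If `a` comes after `x`, then some descent between them crosses the level `x`.
  contrapose!
  intro hle
  have hlt : pos σ x < pos σ a := hle.lt_of_ne fun h =>
    hax.ne' (injOn_pos σ (by simpa using hxN) (by simpa using haN) h)
  obtain ⟨k, hk, hxk, hka⟩ := exists_crossing σ (x := x) (pos_bounds σ hxN).1 hlt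
    (pos_bounds σ haN).2 (letter_pos σ hxN).ge (by rwa [letter_pos σ haN])
  refine card_lt_card ((ssubset_iff_of_subset ?_).2
    ⟨k, mem_filter.2 ⟨hk, hka⟩, fun h => hxk.asymm (mem_filter.1 h).2⟩)
  exact monotone_filter_right _ fun i _ hi => (hi.trans hlt).le

/-- Among the letters below `x`, the letter `c` immediately precedes `b`. -/
def IsPredBelow (x c b : ℕ) : Prop :=
  c ∈ Ico 1 x ∧ pos σ c < pos σ b ∧ ∀ d ∈ Ico 1 x, pos σ d < pos σ b → pos σ d ≤ pos σ c

lemma pos_mem_crossings_iff (hb : 1 ≤ b) (hbx : b < x) (hx : x ≤ N) :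
    pos σ b ∈ crossings σ x ↔
      b ∈ descentBottoms σ ∧ ∀ c, IsPredBelow σ x c b → c ∉ descentTops σ := by
  have hbN : 1 ≤ b ∧ b ≤ N := by omega
  have hpb := pos_bounds σ hbN
  rw [mem_descentBottoms_iff_pos σ hbN, mem_crossings, mem_descents, letter_pos σ hbN]
  constructor
  · rintro ⟨hpos, -, hxb⟩
    refine ⟨⟨hpos, by omega⟩, ?_⟩
    rintro c ⟨hc, hcb, hlast⟩ htop
    rw [mem_Ico] at hc
    have hcN : 1 ≤ c ∧ c ≤ N := by omega
    rw [mem_descentTops_iff_pos σ hcN, mem_descents, Nat.add_sub_cancel, letter_pos σ hcN] at htop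
    have hd := letter_bounds σ (i := pos σ c + 1) (by omega)
    have hnext := hlast (letter σ (pos σ c + 1)) (mem_Ico.2 (by omega))
    rw [pos_letter σ (by omega)] at hnext
    have hadj : pos σ b - 1 = pos σ c := by omega
    rw [hadj, letter_pos σ hcN] at hxb
    omega
  · rintro ⟨⟨hpos, hdesc⟩, hpred⟩
    refine ⟨hpos, hbx, ?_⟩
    by_contra! hlt
    have hc := letter_bounds σ (i := pos σ b - 1) (by omega)
    refine hpred (letter σ (pos σ b - 1)) ⟨mem_Ico.2 (by omega), ?_, fun d _ hd => ?_⟩ ?_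
    · rw [pos_letter σ (by omega)]
      omega
    · rw [pos_letter σ (by omega)]
      omega
    · rw [mem_descentTops_iff_pos σ hc, pos_letter σ (by omega), Nat.sub_add_cancel (by omega),
        mem_descents, letter_pos σ hbN]
      exact ⟨hpos, hdesc⟩

lemma card_crossings_le_pos (hx : x ≤ N) (a : ℕ) :
    #{i ∈ crossings σ x | i ≤ pos σ a} =
      #{b ∈ Ico 1 x | pos σ b ∈ crossings σ x ∧ pos σ b ≤ pos σ a} := by
  refine card_nbij' (letter σ) (pos σ) ?_ ?_ ?_ ?_
  · intro i hi
    simp only [coe_filter, Set.mem_ofPred_eq, mem_Ico] at hi ⊢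
    have h := (mem_crossings σ).1 hi.1
    rw [pos_letter σ (by omega)]
    exact ⟨⟨(letter_bounds σ (by omega)).1, h.2.1⟩, hi⟩
  · intro b hb
    simp only [coe_filter, Set.mem_ofPred_eq] at hb ⊢
    exact hb.2
  · intro i hi
    simp only [coe_filter, Set.mem_ofPred_eq, mem_crossings] at hi
    exact pos_letter σ (by omega)
  · intro b hb
    simp only [coe_filter, Set.mem_ofPred_eq, mem_Ico] at hb
    exact letter_pos σ (by omega)

/-- The letters below `x` come in the same order in `σ` and in `τ`. -/
def SameOrderBelow (x : ℕ) : Prop :=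
  ∀ a ∈ Ico 1 x, ∀ b ∈ Ico 1 x, (pos σ a < pos σ b ↔ pos τ a < pos τ b)

variable {σ τ}

lemma SameOrderBelow.le_iff (h : SameOrderBelow σ τ x) (ha : a ∈ Ico 1 x) (hb : b ∈ Ico 1 x) :
    pos σ a ≤ pos σ b ↔ pos τ a ≤ pos τ b := by
  rw [← not_lt, h b hb a ha, not_lt]

lemma SameOrderBelow.isPredBelow_iff (h : SameOrderBelow σ τ x) (hb : b ∈ Ico 1 x) :
    IsPredBelow σ x c b ↔ IsPredBelow τ x c b := by
  refine and_congr_right fun hc => and_congr (h c hc b hb) (forall₂_congr fun d hd => ?_)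
  rw [h d hd b hb, h.le_iff hd hc]

lemma SameOrderBelow.pos_mem_crossings_congr (h : SameOrderBelow σ τ x) (hx : x ≤ N)
    (hstep : ∀ y ∈ Icc 1 N, step σ y = step τ y) (hb : b ∈ Ico 1 x) :
    pos σ b ∈ crossings σ x ↔ pos τ b ∈ crossings τ x := by
  have htop : ∀ y ∈ Icc 1 N, (y ∈ descentTops σ ↔ y ∈ descentTops τ) := fun y hy => by
    simpa only [step, decide_eq_decide] using congrArg Step.isTop (hstep y hy)
  have hbottom : ∀ y ∈ Icc 1 N, (y ∈ descentBottoms σ ↔ y ∈ descentBottoms τ) := fun y hy => by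
    simpa only [step, decide_eq_decide] using congrArg Step.isBottom (hstep y hy)
  have hmem : ∀ y ∈ Ico 1 x, y ∈ Icc 1 N := fun y hy => by
    rw [mem_Ico] at hy
    exact mem_Icc.2 (by omega)
  have hb' := mem_Ico.1 hb
  rw [pos_mem_crossings_iff σ hb'.1 hb'.2 hx,
    pos_mem_crossings_iff τ hb'.1 hb'.2 hx, hbottom b (hmem b hb)]
  refine and_congr_right fun _ => forall_congr' fun c => ?_
  rw [h.isPredBelow_iff hb]
  exact forall_congr' fun hc => not_congr (htop c (hmem c hc.1))

lemma SameOrderBelow.pos_lt_iff (h : SameOrderBelow σ τ x) (hx : x ≤ N)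
    (hstep : ∀ y ∈ Icc 1 N, step σ y = step τ y) (ha : a ∈ Ico 1 x) :
    pos σ a < pos σ x ↔ pos τ a < pos τ x := by
  have ha' := mem_Ico.1 ha
  have hleft : leftEmb σ x = leftEmb τ x :=
    congrArg Step.left (hstep x (mem_Icc.2 (by omega)))
  rw [pos_lt_pos_iff_card_crossings_le σ ha'.1 ha'.2 hx,
    pos_lt_pos_iff_card_crossings_le τ ha'.1 ha'.2 hx, card_crossings_le_pos σ hx,
    card_crossings_le_pos τ hx, hleft, filter_congr fun b hb =>
      and_congr (h.pos_mem_crossings_congr hx hstep hb) (h.le_iff hb ha)]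

lemma SameOrderBelow.succ (h : SameOrderBelow σ τ x) (hx : x ≤ N)
    (hstep : ∀ y ∈ Icc 1 N, step σ y = step τ y) : SameOrderBelow σ τ (x + 1) := by
  intro a ha b hb
  rw [mem_Ico] at ha hb
  rcases Nat.lt_succ_iff_lt_or_eq.1 ha.2 with hax | rfl <;>
    rcases Nat.lt_succ_iff_lt_or_eq.1 hb.2 with hbx | rfl
  · exact h a (mem_Ico.2 ⟨ha.1, hax⟩) b (mem_Ico.2 ⟨hb.1, hbx⟩)
  · exact h.pos_lt_iff hx hstep (mem_Ico.2 ⟨ha.1, hax⟩)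
  · have hne : ∀ ρ : Equiv.Perm (Fin N), pos ρ a ≠ pos ρ b := fun ρ hρ =>
      hbx.ne' (injOn_pos ρ (by simp; omega) (by simp; omega) hρ)
    have hlt := h.pos_lt_iff hx hstep (mem_Ico.2 ⟨hb.1, hbx⟩)
    have hσ := hne σ
    have hτ := hne τ
    omega
  · simp only [lt_irrefl]

lemma sameOrderBelow_of_step_eq (hstep : ∀ y ∈ Icc 1 N, step σ y = step τ y) (hx : x ≤ N + 1) :
    SameOrderBelow σ τ x := by
  induction x with
  | zero => exact fun a ha => by simp at ha
  | succ x ih => exact (ih (by omega)).succ (by omega) hstep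

lemma SameOrderBelow.eq (h : SameOrderBelow σ τ (N + 1)) : σ = τ := by
  have hpos : ∀ (ρ : Equiv.Perm (Fin N)) (u : Fin N), pos ρ (u + 1) = (ρ⁻¹ u : ℕ) + 1 :=
    fun ρ u => dif_pos (by omega)
  have hlt : ∀ u v : Fin N, σ⁻¹ u < σ⁻¹ v ↔ τ⁻¹ u < τ⁻¹ v := by
    intro u v
    have := h (u + 1) (by simp) (v + 1) (by simp)
    simpa only [hpos, add_lt_add_iff_right, Fin.val_fin_lt] using this
  have hmono : StrictMono (τ⁻¹ * σ) := fun i j hij =>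
    (hlt (σ i) (σ j)).1 (by simpa using hij)
  have hid : τ⁻¹ * σ = 1 := DFunLike.coe_injective <| (hmono.range_inj strictMono_id).1 <| by
    rw [(Equiv.surjective _).range_eq, Set.range_id]
  exact (inv_mul_eq_one.1 hid).symm

lemma code_injective : Function.Injective (code (N := N)) := by
  intro σ τ h
  refine (sameOrderBelow_of_step_eq (fun y hy => ?_) le_rfl).eq
  refine List.map_inj_left.1 h y (List.mem_range'_1.2 ?_)
  rw [mem_Icc] at hy
  omega

end Injectivity

section LaguerreHistories

variable {M : Type*} [AddCommMonoid M] {N : ℕ} (σ : Equiv.Perm (Fin N)) {x : ℕ}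

/-- The height after the step `s` from height `h`. -/
def Step.next (s : Step) (h : ℕ) : ℕ := h + s.isBottom.toNat - s.isTop.toNat

/-- The number of right embracings of a letter whose step from height `h` is `s`. -/
def Step.right (s : Step) (h : ℕ) : ℕ := h - s.isTop.toNat - s.left

/-- The steps that are possible at height `h`: those with at most `h` left embracings, and fewer
than `h` for a descent top. -/
def steps (h : ℕ) : Finset Step :=
  (univ.sigma fun type : Bool × Bool => range (h + 1 - type.1.toNat)).map
    ⟨fun s => ⟨s.1.1, s.1.2, s.2⟩, fun _ _ hs => by simpa [Sigma.ext_iff, Prod.ext_iff, and_assoc]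
      using hs⟩

/-- The Laguerre histories with `n` steps from height `h` to height `0`. -/
def laguerreHistories : ℕ → ℕ → Finset (List Step)
  | 0, h => if h = 0 then {[]} else ∅
  | n + 1, h => (steps h).biUnion fun s => (laguerreHistories n (s.next h)).image (List.cons s)

lemma mem_steps {h : ℕ} {s : Step} : s ∈ steps h ↔ s.left + s.isTop.toNat ≤ h := by
  rw [steps, mem_map]
  constructor
  · rintro ⟨⟨type, l⟩, hl, rfl⟩
    rw [mem_sigma, mem_range] at hl
    exact Nat.le_of_lt_succ (Nat.add_lt_of_lt_sub hl.2)
  · intro hs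
    refine ⟨⟨(s.isTop, s.isBottom), s.left⟩, mem_sigma.2 ⟨mem_univ _, mem_range.2 ?_⟩, rfl⟩
    exact Nat.lt_sub_of_add_lt (Nat.lt_succ_of_le hs)

lemma sum_steps (h : ℕ) (f : Step → M) :
    ∑ s ∈ steps h, f s =
      ∑ isTop : Bool, ∑ isBottom : Bool, ∑ l ∈ range (h + 1 - isTop.toNat),
        f ⟨isTop, isBottom, l⟩ := by
  rw [steps, sum_map, sum_sigma, Fintype.sum_prod_type]
  rfl

lemma sum_laguerreHistories_succ (n h : ℕ) (F : List Step → M) :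
    ∑ L ∈ laguerreHistories (n + 1) h, F L =
      ∑ s ∈ steps h, ∑ L ∈ laguerreHistories n (s.next h), F (s :: L) := by
  rw [laguerreHistories, sum_biUnion]
  · exact sum_congr rfl fun s _ => sum_image fun _ _ _ _ h => (List.cons.inj h).2
  · intro s _ s' _ hne
    rw [Function.onFun, disjoint_left]
    intro L hL hL'
    obtain ⟨L₁, _, rfl⟩ := mem_image.1 hL
    obtain ⟨L₂, _, h⟩ := mem_image.1 hL'
    exact hne (List.cons.inj h).1.symm

lemma card_laguerreHistories (n h : ℕ) :
    #(laguerreHistories n h) = n.factorial * n.choose h := by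
  induction n generalizing h with
  | zero => cases h <;> simp [laguerreHistories]
  | succ n ih =>
    rw [card_eq_sum_ones, sum_laguerreHistories_succ, sum_steps]
    simp only [ih, Step.next, sum_const, card_range, Fintype.sum_bool,
      Bool.toNat_true, Bool.toNat_false, smul_eq_mul, Nat.factorial_succ]
    cases h with
    | zero =>
      simp only [zero_add, tsub_self, Nat.choose_zero_right, mul_one, zero_mul, add_zero, zero_tsub,
        tsub_zero, Nat.choose_one_right, one_mul]
      ring
    | succ h =>
      have hchoose₁ := Nat.add_one_mul_choose_eq n (h + 1)
      have hchoose₂ := Nat.add_one_mul_choose_eq n h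
      simp only [Nat.add_sub_cancel, Nat.sub_zero, add_zero]
      rw [Nat.choose_succ_succ'] at hchoose₁ hchoose₂ ⊢
      zify at hchoose₁ hchoose₂ ⊢
      linear_combination (-n.factorial : ℤ) * (hchoose₁ + hchoose₂)

lemma height_succ (x : ℕ) : height σ (x + 1) = (step σ x).next (height σ x) := by
  rw [height_succ_eq_card_embracings_add, height_eq_card_embracings_add, Step.next, step]
  split_ifs <;> simp [*]

lemma leftEmb_add_rightEmb_add_toNat (hx : 1 ≤ x ∧ x ≤ N) :
    leftEmb σ x + rightEmb σ x + (step σ x).isTop.toNat = height σ x := by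
  rw [leftEmb_add_rightEmb σ hx, height_eq_card_embracings_add, step]
  split_ifs <;> simp [*]

lemma rightEmb_eq_step_right (hx : 1 ≤ x ∧ x ≤ N) :
    rightEmb σ x = (step σ x).right (height σ x) := by
  have hleft : (step σ x).left = leftEmb σ x := rfl
  rw [Step.right, ← leftEmb_add_rightEmb_add_toNat σ hx]
  omega

lemma step_mem_steps (hx : 1 ≤ x ∧ x ≤ N) : step σ x ∈ steps (height σ x) := by
  have hleft : (step σ x).left = leftEmb σ x := rfl
  rw [mem_steps, ← leftEmb_add_rightEmb_add_toNat σ hx]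
  omega

lemma map_step_mem_laguerreHistories {k : ℕ} (hx : 1 ≤ x) (h : x + k = N + 1) :
    (List.range' x k).map (step σ) ∈ laguerreHistories k (height σ x) := by
  induction k generalizing x with
  | zero =>
    obtain rfl : x = N + 1 := h
    simp [laguerreHistories, height_last]
  | succ k ih =>
    rw [List.range'_succ, List.map_cons, laguerreHistories, mem_biUnion]
    refine ⟨step σ x, step_mem_steps σ (by omega), mem_image_of_mem _ ?_⟩
    rw [← height_succ]
    exact ih (by omega) (by omega)

lemma code_mem_laguerreHistories : code σ ∈ laguerreHistories N 0 := by
  rw [← height_one σ]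
  exact map_step_mem_laguerreHistories σ le_rfl (add_comm 1 N)

lemma image_code : univ.image (code (N := N)) = laguerreHistories N 0 := by
  refine eq_of_subset_of_card_le
    (image_subset_iff.2 fun σ _ => code_mem_laguerreHistories σ) (le_of_eq ?_)
  rw [card_image_of_injective _ code_injective, card_laguerreHistories, card_univ,
    Fintype.card_perm, Fintype.card_fin, Nat.choose_zero_right, mul_one]

lemma sum_code (F : List Step → M) :
    ∑ σ : Equiv.Perm (Fin N), F (code σ) = ∑ L ∈ laguerreHistories N 0, F L := by
  rw [← image_code, sum_image fun _ _ _ _ h => code_injective h]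

end LaguerreHistories

/-! ### Motzkin paths -/

section MotzkinPaths

variable {R : Type*} [CommSemiring R] (b u d : ℕ → R)

/-- The operator on functions of the height that adds a first step to weighted Motzkin paths: from
height `h`, level, up and down steps have the weights `b h`, `u h` and `d h`. At height `0` the
truncated subtraction makes a down step go to height `0`, so that `d 0 = 0` is wanted. -/
def motzkinStep (z : ℕ → R) (h : ℕ) : R :=
  b h * z h + u h * z (h + 1) + d h * z (h - 1)

/-- The total weight of the Motzkin paths with `n` steps from height `h` to height `0`. -/
def motzkin : ℕ → ℕ → R
  | 0 => fun h => if h = 0 then 1 else 0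
  | n + 1 => motzkinStep b u d (motzkin n)

lemma motzkin_const_mul (c : R) (n h : ℕ) :
    motzkin (fun h => c * b h) (fun h => c * u h) (fun h => c * d h) n h =
      c ^ n * motzkin b u d n h := by
  induction n generalizing h with
  | zero => simp [motzkin]
  | succ n ih =>
    simp only [motzkin, motzkinStep, ih]
    ring

lemma sum_mul_motzkinStep (hud : ∀ h, u h = d (h + 1)) (hd : d 0 = 0) (f z : ℕ → R) {m : ℕ}
    (hf : ∀ h, m < h → f h = 0) :
    ∑ h ∈ range (m + 1), f h * motzkinStep b u d z h =
      ∑ h ∈ range (m + 2), motzkinStep b u d f h * z h := by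
  have hup : ∑ h ∈ range (m + 1), f h * (u h * z (h + 1)) =
      ∑ h ∈ range (m + 2), d h * f (h - 1) * z h := by
    rw [sum_range_succ' _ (m + 1), hd, zero_mul, zero_mul, add_zero]
    refine sum_congr rfl fun h _ => ?_
    rw [hud, Nat.add_sub_cancel]
    ring
  have hdown : ∑ h ∈ range (m + 1), f h * (d h * z (h - 1)) =
      ∑ h ∈ range (m + 2), u h * f (h + 1) * z h := by
    rw [sum_range_succ', hd, zero_mul, mul_zero, add_zero, sum_range_succ, sum_range_succ,
      hf (m + 1) (by omega), hf (m + 1 + 1) (by omega), mul_zero, zero_mul, mul_zero, zero_mul,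
      add_zero, add_zero]
    refine sum_congr rfl fun h _ => ?_
    rw [hud, Nat.add_sub_cancel]
    ring
  have hlevel : ∑ h ∈ range (m + 1), f h * (b h * z h) =
      ∑ h ∈ range (m + 2), b h * f h * z h := by
    rw [sum_range_succ _ (m + 1), hf (m + 1) (by omega), mul_zero, zero_mul, add_zero]
    exact sum_congr rfl fun h _ => by ring
  simp only [motzkinStep, mul_add, add_mul, sum_add_distrib, hlevel, hup, hdown]
  ring

variable {b u d}

/-- The product of the weights `w h s₁ s₂` of the consecutive disjoint pairs of steps `s₁`, `s₂`,
from height `h`, of a Laguerre history. -/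
def pairsWeight (w : ℕ → Step → Step → R) : ℕ → List Step → R
  | h, s₁ :: s₂ :: L => w h s₁ s₂ * pairsWeight w (s₂.next (s₁.next h)) L
  | _, _ => 1

lemma sum_pairsWeight {w : ℕ → Step → Step → R}
    (hw : ∀ (z : ℕ → R) (h : ℕ), ∑ s₁ ∈ steps h, ∑ s₂ ∈ steps (s₁.next h),
      w h s₁ s₂ * z (s₂.next (s₁.next h)) = motzkinStep b u d z h) (n h : ℕ) :
    ∑ L ∈ laguerreHistories (2 * n) h, pairsWeight w h L = motzkin b u d n h := by
  induction n generalizing h with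
  | zero =>
    simp only [laguerreHistories, motzkin]
    split_ifs <;> simp [pairsWeight]
  | succ n ih =>
    rw [mul_add_one, sum_laguerreHistories_succ, motzkin, ← hw]
    refine sum_congr rfl fun s₁ _ => ?_
    rw [sum_laguerreHistories_succ]
    refine sum_congr rfl fun s₂ _ => ?_
    simp only [pairsWeight, ← mul_sum, ih]

end MotzkinPaths

section PairSums

variable {R : Type*} [CommSemiring R] (p q : R) {m : ℕ}

lemma pqNat_comm (n : ℕ) : pqNat p q n = pqNat q p n := by
  rw [pqNat, ← sum_range_reflect]
  refine sum_congr rfl fun i hi => ?_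
  rw [Nat.sub_sub_self (by rw [mem_range] at hi; omega), mul_comm]

lemma pqNat_one : pqNat p q 1 = 1 := by
  simp [pqNat]

lemma pqNat_two : pqNat p q 2 = p + q := by
  simp [pqNat, sum_range_succ]

lemma add_mul_sum_even (hm : Even m) :
    (p + q) * ∑ l ∈ range m, (if Even l then p ^ (m - 1 - l - 1) * q ^ l else 0) =
      pqNat p q m := by
  obtain ⟨k, rfl⟩ := even_iff_exists_two_mul.1 hm
  rw [pqNat, sum_range_two_mul, sum_range_two_mul, mul_sum]
  refine sum_congr rfl fun i hi => ?_
  obtain ⟨j, rfl⟩ := Nat.exists_eq_add_of_lt (mem_range.1 hi)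
  rw [if_pos (even_two_mul i), if_neg (by simp),
    show 2 * (i + j + 1) - 1 - 2 * i - 1 = 2 * j by omega,
    show 2 * (i + j + 1) - 1 - 2 * i = 2 * j + 1 by omega,
    show 2 * (i + j + 1) - 1 - (2 * i + 1) = 2 * j by omega]
  ring

lemma add_mul_sum_sum_even (hm : Even m) (n : ℕ) :
    (p + q) * ∑ l ∈ range m, ∑ k ∈ range n,
      (if Even l then p ^ (m - 1 - l + (n - 1 - k) - 1) * q ^ (l + k) else 0) =
        pqNat p q m * pqNat p q n := by
  rw [← add_mul_sum_even p q hm, pqNat, mul_assoc, sum_mul_sum]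
  refine congrArg _ (sum_congr rfl fun l hl => sum_congr rfl fun k _ => ?_)
  by_cases hle : Even l
  · have : m - 1 - l ≠ 0 := by
      rw [mem_range] at hl
      grind
    rw [if_pos hle, if_pos hle, Nat.sub_add_comm (by omega)]
    ring
  · rw [if_neg hle, if_neg hle, zero_mul]

lemma sum_level (h : ℕ) :
    ∑ l₁ ∈ range (h + 1), ∑ l₂ ∈ range (h + 1), p ^ (h - l₁ + (h - l₂)) * q ^ (l₁ + l₂) =
      pqNat p q (h + 1) ^ 2 := by
  rw [sq, pqNat, sum_mul_sum]
  refine sum_congr rfl fun _ _ => sum_congr rfl fun _ _ => ?_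
  rw [Nat.add_sub_cancel]
  ring

lemma add_mul_sum_up (h : ℕ) :
    (p + q) * ∑ l₁ ∈ range (h + 1), ∑ l₂ ∈ range (h + 2),
      (if (Odd (h + 1) → Even l₂) ∧ (Even (h + 1) → Even l₁) then
        p ^ (h - l₁ + (h + 1 - l₂) - 1) * q ^ (l₁ + l₂) else 0) =
      pqNat p q (h + 1) * pqNat p q (h + 2) := by
  rcases Nat.even_or_odd (h + 1) with he | ho
  · have ho : ¬ Odd (h + 1) := Nat.not_odd_iff_even.2 he
    simp only [he, ho, true_imp_iff, false_imp_iff, true_and]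
    exact add_mul_sum_sum_even p q he (h + 2)
  · have he : ¬ Even (h + 1) := Nat.not_even_iff_odd.2 ho
    simp only [he, ho, true_imp_iff, false_imp_iff, and_true]
    rw [sum_comm, mul_comm (pqNat p q (h + 1)), ← add_mul_sum_sum_even p q (m := h + 2) ho.add_one]
    simp only [Nat.add_sub_cancel, add_comm]
    rfl

lemma add_mul_sum_down (h : ℕ) :
    (p + q) * ∑ l₁ ∈ range (h + 1), ∑ l₂ ∈ range h,
      (if (Odd h → Even (h - l₁)) ∧ (Even h → Even (h - 1 - l₂)) then
        p ^ (h - l₁ + (h - 1 - l₂)) * q ^ (l₁ + l₂ - 1) else 0) =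
      pqNat p q (h + 1) * pqNat p q h := by
  cases h with
  | zero => simp [pqNat]
  | succ h =>
    -- The reflections `l₁ ↦ h + 1 - l₁`, `l₂ ↦ h - l₂` turn this into the sum over up steps from
    -- height `h`, with `p` and `q` exchanged.
    rw [mul_comm (pqNat p q _), pqNat_comm p q, pqNat_comm p q, ← add_mul_sum_up, add_comm p,
      sum_comm, ← sum_range_reflect]
    refine congrArg _ (sum_congr rfl fun k hk => ?_)
    rw [← sum_range_reflect]
    refine sum_congr rfl fun l hl => ?_
    rw [mem_range] at hk hl
    simp only [Nat.add_sub_cancel, Nat.sub_sub_self (Nat.le_of_lt_succ hk),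
      Nat.sub_sub_self (Nat.le_of_lt_succ hl)]
    rw [add_comm l k, add_comm (h - k), mul_comm]

end PairSums

section PairWeights

/-- The condition that normalized E-permutations put on the steps `s₁` of the letter `2j - 1` and
`s₂` of the letter `2j`, when `s₁` starts from height `h`. The signature function takes the value
`h + 1` at `2j - 1` if this letter is a descent bottom, and `s₁.next h` at `2j` if this letter is a
descent top. -/
def NormalPair (h : ℕ) (s₁ s₂ : Step) : Prop :=
  (s₁.isTop = false ∧ s₂.isBottom = false ∧ ¬ (s₁.isBottom = true ∧ s₂.isTop = true)) ∧
  (s₁.isBottom = true → (Odd (h + 1) → Even s₂.left) ∧ (Even (h + 1) → Even s₁.left)) ∧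
  (s₂.isTop = true → (Odd (s₁.next h) → Even (s₁.right h)) ∧
    (Even (s₁.next h) → Even (s₂.right (s₁.next h))))

instance (h : ℕ) (s₁ s₂ : Step) : Decidable (NormalPair h s₁ s₂) := by
  unfold NormalPair; infer_instance

/-- The contribution of the letters `2j - 1` and `2j`, with the steps `s₁` from height `h` and `s₂`,
to the weight of a normalized E-permutation. Its descents are counted by their bottoms in the
exponents of `p` and `t`, and by their tops in the exponent of `q`. -/
def pairWeight {R : Type*} [CommSemiring R] (p q t : R) (h : ℕ) (s₁ s₂ : Step) : R :=
  if NormalPair h s₁ s₂ then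
    p ^ (s₁.right h + s₂.right (s₁.next h) - s₁.isBottom.toNat) *
      q ^ (s₁.left + s₂.left - s₂.isTop.toNat) * t ^ s₁.isBottom.toNat
  else 0

lemma sum_pairWeight {K : Type*} [Field K] (p q t : K) (hpq : p + q ≠ 0) (z : ℕ → K) (h : ℕ) :
    ∑ s₁ ∈ steps h, ∑ s₂ ∈ steps (s₁.next h), pairWeight p q t h s₁ s₂ * z (s₂.next (s₁.next h)) =
      motzkinStep (fun h => pqNat p q (h + 1) ^ 2)
        (fun h => pqNat p q (h + 1) * pqNat p q (h + 2) / (p + q) * t)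
        (fun h => pqNat p q (h + 1) * pqNat p q h / (p + q)) z h := by
  simp only [motzkinStep, ← sum_level, ← add_mul_sum_up, ← add_mul_sum_down,
    mul_div_cancel_left₀ _ hpq]
  simp only [sum_steps, Fintype.sum_bool, pairWeight, NormalPair, Step.next, Step.right,
    Bool.toNat_true, Bool.toNat_false, reduceCtorEq, false_and, and_false, if_false, zero_mul,
    sum_const_zero, add_zero, zero_add, Nat.sub_zero, true_and, not_false_eq_true, and_true,
    if_true, not_true_eq_false, pow_zero, mul_one, pow_one, false_implies, forall_const,
    sum_mul, sum_add_distrib, ite_mul, Nat.add_sub_cancel]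
  ring

end PairWeights

/-! ### Normalized E-permutations -/

section Pairs

variable {N : ℕ} (σ : Equiv.Perm (Fin N))

lemma height_two_mul {j : ℕ} (hj : 1 ≤ j) :
    height σ (2 * j) = (step σ (2 * j - 1)).next (height σ (2 * j - 1)) := by
  rw [← height_succ, Nat.sub_add_cancel (by omega)]

lemma pairsWeight_map_step {R : Type*} [CommSemiring R] (w : ℕ → Step → Step → R) {m : ℕ}
    (hm : 1 ≤ m) (k : ℕ) :
    pairsWeight w (height σ (2 * m - 1)) ((List.range' (2 * m - 1) (2 * k)).map (step σ)) =
      ∏ j ∈ Ico m (m + k), w (height σ (2 * j - 1)) (step σ (2 * j - 1)) (step σ (2 * j)) := by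
  induction k generalizing m with
  | zero => simp [pairsWeight]
  | succ k ih =>
    rw [prod_eq_prod_Ico_succ_bot (by omega), ← Nat.add_assoc, Nat.add_right_comm m k 1,
      ← ih (Nat.le_add_left 1 m), Nat.mul_succ, List.range'_succ, List.range'_succ, List.map_cons,
      List.map_cons, pairsWeight, Nat.sub_add_cancel (by omega), ← height_two_mul σ hm,
      ← height_succ]
    rfl

end Pairs

section Normalized

variable {n : ℕ} {σ : Equiv.Perm (Fin (2 * n))} {j x : ℕ}

lemma isEvenOdd_iff :
    IsEvenOdd σ ↔ (∀ x ∈ descentTops σ, Even x) ∧ ∀ x ∈ descentBottoms σ, Odd x := by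
  simp only [IsEvenOdd, descentTops, descentBottoms, forall_mem_image, mem_filter, and_imp,
    forall_and]

lemma IsEPerm.even_of_mem_descentTops (h : IsEPerm σ) (hx : x ∈ descentTops σ) : Even x :=
  (isEvenOdd_iff.1 h.1).1 x hx

lemma IsEPerm.odd_of_mem_descentBottoms (h : IsEPerm σ) (hx : x ∈ descentBottoms σ) : Odd x :=
  (isEvenOdd_iff.1 h.1).2 x hx

lemma isEPerm_iff :
    IsEPerm σ ↔ ∀ j ∈ Icc 1 n, 2 * j - 1 ∉ descentTops σ ∧ 2 * j ∉ descentBottoms σ ∧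
      ¬ (2 * j - 1 ∈ descentBottoms σ ∧ 2 * j ∈ descentTops σ) := by
  constructor
  · intro h j hj
    have hj1 := (mem_Icc.1 hj).1
    refine ⟨fun ht => ?_, fun hb => ?_, h.2 j hj⟩
    · have := h.even_of_mem_descentTops ht
      grind
    · have := h.odd_of_mem_descentBottoms hb
      grind
  · intro h
    refine ⟨isEvenOdd_iff.2 ⟨fun x hx => ?_, fun x hx => ?_⟩, fun j hj => (h j hj).2.2⟩
    · have hx' := mem_Icc.1 (descentTops_subset σ hx)
      by_contra ho
      obtain ⟨k, rfl⟩ := Nat.not_even_iff_odd.1 ho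
      exact (h (k + 1) (mem_Icc.2 (by omega))).1 hx
    · have hx' := mem_Icc.1 (descentBottoms_subset σ hx)
      by_contra he
      obtain ⟨k, rfl⟩ := even_iff_exists_two_mul.1 (Nat.not_odd_iff_even.1 he)
      exact (h k (mem_Icc.2 (by omega))).2.1 hx

lemma IsEPerm.mem_signature_and_odd_iff (h : IsEPerm σ) :
    x ∈ signature σ ∧ Odd x ↔ x ∈ descentBottoms σ := by
  rw [signature, mem_union]
  refine ⟨?_, fun hx => ⟨Or.inr hx, h.odd_of_mem_descentBottoms hx⟩⟩
  rintro ⟨ht | hb, ho⟩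
  · exact absurd (h.even_of_mem_descentTops ht) (Nat.not_even_iff_odd.2 ho)
  · exact hb

lemma IsEPerm.mem_signature_and_even_iff (h : IsEPerm σ) :
    x ∈ signature σ ∧ Even x ↔ x ∈ descentTops σ := by
  rw [signature, mem_union]
  refine ⟨?_, fun hx => ⟨Or.inl hx, h.even_of_mem_descentTops hx⟩⟩
  rintro ⟨ht | hb, he⟩
  · exact ht
  · exact absurd (h.odd_of_mem_descentBottoms hb) (Nat.not_odd_iff_even.2 he)

lemma IsEPerm.sigFun_eq (h : IsEPerm σ) (x : ℕ) :
    sigFun (signature σ) x = (height σ x + if x ∈ descentTops σ then 0 else 1 : ℕ) := by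
  have hmem : ((x ∈ signature σ ∧ Odd x) ∨ x ∉ signature σ) ↔ x ∉ descentTops σ := by
    rw [← h.mem_signature_and_even_iff, ← Nat.not_odd_iff_even]
    tauto
  have hodd : {y ∈ signature σ | Odd y ∧ y < x} = {y ∈ descentBottoms σ | y < x} := by
    ext y
    simp only [mem_filter, ← and_assoc, h.mem_signature_and_odd_iff]
  have heven : {y ∈ signature σ | Even y ∧ y < x} = {y ∈ descentTops σ | y < x} := by
    ext y
    simp only [mem_filter, ← and_assoc, h.mem_signature_and_even_iff]
  rw [sigFun, hodd, heven, ← height_add_card_descentTops_lt]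
  simp only [hmem, ite_not]
  push_cast
  ring

lemma normalPair_iff (h : IsEPerm σ) (hj : j ∈ Icc 1 n) :
    NormalPair (height σ (2 * j - 1)) (step σ (2 * j - 1)) (step σ (2 * j)) ↔
      (2 * j - 1 ∈ signature σ → Odd (sigFun (signature σ) (2 * j - 1)) →
        Even (leftEmb σ (2 * j))) ∧
      (2 * j - 1 ∈ signature σ → Even (sigFun (signature σ) (2 * j - 1)) →
        Even (leftEmb σ (2 * j - 1))) ∧
      (2 * j ∈ signature σ → Odd (sigFun (signature σ) (2 * j)) →
        Even (rightEmb σ (2 * j - 1))) ∧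
      (2 * j ∈ signature σ → Even (sigFun (signature σ) (2 * j)) →
        Even (rightEmb σ (2 * j))) := by
  obtain ⟨ht, hb, htb⟩ := isEPerm_iff.1 h j hj
  rw [mem_Icc] at hj
  have hodd : 2 * j - 1 ∈ signature σ ↔ (step σ (2 * j - 1)).isBottom = true := by
    simp [signature, ht, step]
  have heven : 2 * j ∈ signature σ ↔ (step σ (2 * j)).isTop = true := by
    simp [signature, hb, step]
  have hsigOdd : sigFun (signature σ) (2 * j - 1) = (height σ (2 * j - 1) + 1 : ℕ) := by
    rw [h.sigFun_eq, if_neg ht]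
  have hsigEven (hx : 2 * j ∈ signature σ) : sigFun (signature σ) (2 * j) = height σ (2 * j) := by
    rw [h.sigFun_eq, if_pos (h.mem_signature_and_even_iff.1 ⟨hx, even_two_mul j⟩), Nat.add_zero]
  have hclass : (step σ (2 * j - 1)).isTop = false ∧ (step σ (2 * j)).isBottom = false ∧
      ¬ ((step σ (2 * j - 1)).isBottom = true ∧ (step σ (2 * j)).isTop = true) := by
    simp only [step, decide_eq_false_iff_not, decide_eq_true_eq]
    exact ⟨ht, hb, htb⟩
  rw [NormalPair, and_iff_right hclass, ← hodd, ← heven, ← height_two_mul σ hj.1,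
    ← rightEmb_eq_step_right σ (by omega), ← rightEmb_eq_step_right σ (by omega), hsigOdd,
    imp_and, imp_and, and_assoc]
  simp only [Int.odd_coe_nat, Int.even_coe_nat]
  refine and_congr Iff.rfl (and_congr Iff.rfl (and_congr ?_ ?_))
  · exact imp_congr_right fun hx => by rw [hsigEven hx, Int.odd_coe_nat]
  · exact imp_congr_right fun hx => by rw [hsigEven hx, Int.even_coe_nat]

lemma isNormalized_iff :
    IsNormalized σ ↔ ∀ j ∈ Icc 1 n,
      NormalPair (height σ (2 * j - 1)) (step σ (2 * j - 1)) (step σ (2 * j)) := by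
  constructor
  · rintro ⟨he, h⟩ j hj
    exact (normalPair_iff he hj).2 (h j hj)
  · intro h
    have he : IsEPerm σ := isEPerm_iff.2 fun j hj => by
      simpa only [step, decide_eq_false_iff_not, decide_eq_true_eq] using (h j hj).1
    exact ⟨he, fun j hj => (normalPair_iff he hj).1 (h j hj)⟩

lemma NormalPair.isBottom_le_right {h : ℕ} {s₁ s₂ : Step} (hn : NormalPair h s₁ s₂)
    (h₁ : s₁ ∈ steps h) (h₂ : s₂ ∈ steps (s₁.next h)) :
    s₁.isBottom.toNat ≤ s₁.right h + s₂.right (s₁.next h) := by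
  obtain ⟨⟨ht₁, -, hbt⟩, hbottom, -⟩ := hn
  cases hb : s₁.isBottom with
  | false => exact Nat.zero_le _
  | true =>
    -- Either `s₂.left` is even and at most the odd number `h + 1`, or `s₁.left` is even and at most
    -- the odd number `h`; in both cases the inequality is strict.
    have ht₂ : s₂.isTop = false := by simpa only [hb, true_and, Bool.not_eq_true] using hbt
    simp only [mem_steps, Step.next, Step.right, ht₁, ht₂, hb, Bool.toNat_true, Bool.toNat_false,
      add_zero, Nat.sub_zero] at h₁ h₂ ⊢
    obtain ⟨hoddh, hevenh⟩ := hbottom hb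
    rcases Nat.even_or_odd (h + 1) with he | ho
    · have := hevenh he
      grind
    · have := hoddh ho
      grind

lemma NormalPair.isTop_le_left {h : ℕ} {s₁ s₂ : Step} (hn : NormalPair h s₁ s₂)
    (h₁ : s₁ ∈ steps h) (h₂ : s₂ ∈ steps (s₁.next h)) :
    s₂.isTop.toNat ≤ s₁.left + s₂.left := by
  obtain ⟨⟨ht₁, -, hbt⟩, -, htop⟩ := hn
  cases ht₂ : s₂.isTop with
  | false => exact Nat.zero_le _
  | true =>
    have hb : s₁.isBottom = false := by simpa only [ht₂, and_true, Bool.not_eq_true] using hbt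
    have hnext : s₁.next h = h := by simp [Step.next, ht₁, hb]
    rw [hnext] at htop h₂
    simp only [mem_steps, Step.right, ht₁, ht₂, Bool.toNat_true, Bool.toNat_false, add_zero,
      Nat.sub_zero] at h₁ h₂ htop ⊢
    obtain ⟨hoddh, hevenh⟩ := htop trivial
    rcases Nat.even_or_odd h with he | ho
    · have := hevenh he
      grind
    · have := hoddh ho
      grind

lemma IsEPerm.des_eq_sum_isBottom (h : IsEPerm σ) :
    des σ = ∑ j ∈ Icc 1 n, (step σ (2 * j - 1)).isBottom.toNat := by
  rw [des_eq_sum_descentBottoms, sum_Icc_one_two_mul]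
  refine sum_congr rfl fun j hj => ?_
  rw [if_neg (isEPerm_iff.1 h j hj).2.1, add_zero, step, Bool.toNat, Bool.cond_decide]

lemma IsEPerm.des_eq_sum_isTop (h : IsEPerm σ) :
    des σ = ∑ j ∈ Icc 1 n, (step σ (2 * j)).isTop.toNat := by
  rw [des_eq_sum_descentTops, sum_Icc_one_two_mul]
  refine sum_congr rfl fun j hj => ?_
  rw [if_neg (isEPerm_iff.1 h j hj).1, zero_add, step, Bool.toNat, Bool.cond_decide]

variable (σ) in
lemma les_eq_sum_left :
    les σ = ∑ j ∈ Icc 1 n, ((step σ (2 * j - 1)).left + (step σ (2 * j)).left) := by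
  rw [les_eq_sum_leftEmb, sum_Icc_one_two_mul]
  rfl

variable (σ) in
lemma res_eq_sum_right :
    res σ = ∑ j ∈ Icc 1 n, ((step σ (2 * j - 1)).right (height σ (2 * j - 1)) +
      (step σ (2 * j)).right ((step σ (2 * j - 1)).next (height σ (2 * j - 1)))) := by
  rw [res_eq_sum_rightEmb, sum_Icc_one_two_mul]
  refine sum_congr rfl fun j hj => ?_
  rw [mem_Icc] at hj
  rw [← height_two_mul σ hj.1, rightEmb_eq_step_right σ (by omega),
    rightEmb_eq_step_right σ (by omega)]

variable (σ) in
lemma step_pair_mem_steps (hj : j ∈ Icc 1 n) :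
    step σ (2 * j - 1) ∈ steps (height σ (2 * j - 1)) ∧
      step σ (2 * j) ∈ steps ((step σ (2 * j - 1)).next (height σ (2 * j - 1))) := by
  rw [mem_Icc] at hj
  rw [← height_two_mul σ hj.1]
  exact ⟨step_mem_steps σ (by omega), step_mem_steps σ (by omega)⟩

lemma IsNormalized.isBottom_le_right (h : IsNormalized σ) (hj : j ∈ Icc 1 n) :
    (step σ (2 * j - 1)).isBottom.toNat ≤ (step σ (2 * j - 1)).right (height σ (2 * j - 1)) +
      (step σ (2 * j)).right ((step σ (2 * j - 1)).next (height σ (2 * j - 1))) :=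
  (isNormalized_iff.1 h j hj).isBottom_le_right (step_pair_mem_steps σ hj).1
    (step_pair_mem_steps σ hj).2

lemma IsNormalized.isTop_le_left (h : IsNormalized σ) (hj : j ∈ Icc 1 n) :
    (step σ (2 * j)).isTop.toNat ≤ (step σ (2 * j - 1)).left + (step σ (2 * j)).left :=
  (isNormalized_iff.1 h j hj).isTop_le_left (step_pair_mem_steps σ hj).1
    (step_pair_mem_steps σ hj).2

lemma IsNormalized.des_le_res (h : IsNormalized σ) : des σ ≤ res σ := by
  rw [h.1.des_eq_sum_isBottom, res_eq_sum_right]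
  exact sum_le_sum fun j hj => h.isBottom_le_right hj

lemma IsNormalized.des_le_les (h : IsNormalized σ) : des σ ≤ les σ := by
  rw [h.1.des_eq_sum_isTop, les_eq_sum_left]
  exact sum_le_sum fun j hj => h.isTop_le_left hj

lemma IsNormalized.prod_pairWeight {R : Type*} [CommSemiring R] (h : IsNormalized σ) (p q t : R) :
    ∏ j ∈ Icc 1 n,
      pairWeight p q t (height σ (2 * j - 1)) (step σ (2 * j - 1)) (step σ (2 * j)) =
        p ^ (res σ - des σ) * q ^ (les σ - des σ) * t ^ des σ := by
  have hl : les σ - des σ = ∑ j ∈ Icc 1 n,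
      ((step σ (2 * j - 1)).left + (step σ (2 * j)).left - (step σ (2 * j)).isTop.toNat) := by
    rw [sum_tsub_distrib _ fun j hj => h.isTop_le_left hj, ← h.1.des_eq_sum_isTop,
      ← les_eq_sum_left]
  rw [hl, h.1.des_eq_sum_isBottom, res_eq_sum_right,
    ← sum_tsub_distrib _ fun j hj => h.isBottom_le_right hj, ← prod_pow_eq_pow_sum,
    ← prod_pow_eq_pow_sum, ← prod_pow_eq_pow_sum, ← prod_mul_distrib, ← prod_mul_distrib]
  exact prod_congr rfl fun j hj => if_pos (isNormalized_iff.1 h j hj)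

lemma pairsWeight_code {R : Type*} [CommSemiring R] (σ : Equiv.Perm (Fin (2 * n))) (p q t : R) :
    pairsWeight (pairWeight p q t) 0 (code σ) =
      if IsNormalized σ then p ^ (res σ - des σ) * q ^ (les σ - des σ) * t ^ des σ else 0 := by
  rw [code, ← height_one σ, pairsWeight_map_step σ _ le_rfl, Nat.add_comm 1 n]
  split_ifs with h
  · exact h.prod_pairWeight p q t
  · rw [isNormalized_iff] at h
    push Not at h
    obtain ⟨j, hj, hn⟩ := h
    exact prod_eq_zero hj (if_neg hn)

end Normalized

lemma sum_normalizedEPerms {K : Type*} [Field K] (p q t : K) (hpq : p + q ≠ 0) (n : ℕ) :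
    ∑ σ ∈ normalizedEPerms n, p ^ (res σ - des σ) * q ^ (les σ - des σ) * t ^ des σ =
      motzkin (fun h => pqNat p q (h + 1) ^ 2)
        (fun h => pqNat p q (h + 1) * pqNat p q (h + 2) / (p + q) * t)
        (fun h => pqNat p q (h + 1) * pqNat p q h / (p + q)) n 0 := by
  rw [← sum_pairsWeight (sum_pairWeight p q t hpq), ← sum_code, normalizedEPerms, sum_filter]
  exact sum_congr rfl fun σ _ => (pairsWeight_code σ p q t).symm

/-! ### J-fractions -/

section JFraction

open PowerSeries

variable {K : Type*} [Field K] (b u d lam : ℕ → K)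

/-- The generating function of the Motzkin paths from height `h` to height `0`. -/
noncomputable def motzkinSeries (h : ℕ) : PowerSeries K :=
  PowerSeries.mk fun n => motzkin b u d n h

/-- The part of `motzkinSeries b u d h` that comes from the empty path and from the paths with a
down step first. -/
noncomputable def motzkinSource (h : ℕ) : PowerSeries K :=
  if h = 0 then 1 else C (d h) * X * motzkinSeries b u d (h - 1)

variable {d}

lemma motzkinSeries_eq (hd : d 0 = 0) (h : ℕ) :
    motzkinSeries b u d h = motzkinSource b u d h +
      X * (C (b h) * motzkinSeries b u d h + C (u h) * motzkinSeries b u d (h + 1)) := by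
  rw [motzkinSource]
  ext n
  cases n with
  | zero => split_ifs with h0 <;> simp [motzkinSeries, motzkin, h0, mul_assoc]
  | succ n =>
    rw [map_add, coeff_succ_X_mul]
    split_ifs with h0
    · simp [motzkinSeries, motzkin, motzkinStep, coeff_one, h0, hd]
    · rw [mul_right_comm, coeff_succ_mul_X]
      simp [motzkinSeries, motzkin, motzkinStep, add_comm]

lemma jConvergent_succ_mul (m k : ℕ) :
    jConvergent b lam (m + 1) k *
      (1 - C (b k) * X - C (lam (k + 1)) * X ^ 2 * jConvergent b lam m (k + 1)) = 1 := by
  rw [jConvergent, mul_comm]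
  exact PowerSeries.mul_inv_cancel _ (by simp)

variable {b u lam}

lemma X_pow_dvd_motzkinSeries_sub_jConvergent_mul (hd : d 0 = 0)
    (hlam : ∀ h, lam (h + 1) = u h * d (h + 1)) (m h : ℕ) :
    X ^ m ∣ motzkinSeries b u d h - jConvergent b lam m h * motzkinSource b u d h := by
  induction m generalizing h with
  | zero => simp
  | succ m ih =>
    obtain ⟨e, he⟩ := ih (h + 1)
    have hseries := motzkinSeries_eq b u hd h
    have hconv := jConvergent_succ_mul b lam m h
    rw [motzkinSource, if_neg h.succ_ne_zero, Nat.add_sub_cancel] at he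
    rw [hlam, map_mul] at hconv
    refine ⟨jConvergent b lam (m + 1) h * C (u h) * e, ?_⟩
    linear_combination (-motzkinSeries b u d h) * hconv + jConvergent b lam (m + 1) h * hseries +
      jConvergent b lam (m + 1) h * C (u h) * X * he

lemma hasJFraction_motzkin (hd : d 0 = 0) (hlam : ∀ h, lam (h + 1) = u h * d (h + 1)) :
    HasJFraction (PowerSeries.mk fun n => motzkin b u d n 0) b lam := by
  intro n
  filter_upwards [Filter.eventually_gt_atTop n] with m hm
  have hdvd := X_pow_dvd_motzkinSeries_sub_jConvergent_mul (b := b) hd hlam m 0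
  rw [motzkinSource, if_pos rfl, mul_one] at hdvd
  have hcoeff := X_pow_dvd_iff.1 hdvd n hm
  rw [map_sub, sub_eq_zero] at hcoeff
  exact hcoeff.symm

end JFraction

lemma hasJFraction_normalizedEPerms {K : Type*} [Field K] (p q t : K) (hpq : p + q ≠ 0) :
    HasJFraction
      (PowerSeries.mk fun n => ∑ σ ∈ normalizedEPerms n,
        p ^ (res σ - des σ) * q ^ (les σ - des σ) * t ^ des σ)
      (fun n => pqNat p q (n + 1) ^ 2) (fun n => pqBinom p q (n + 1) 2 ^ 2 * t) := by
  simp only [sum_normalizedEPerms p q t hpq]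
  refine hasJFraction_motzkin (by simp [pqNat]) fun h => ?_
  simp only [pqBinom, prod_range_succ, range_zero, prod_empty, one_mul, Nat.sub_zero, zero_add,
    pqNat_one, Nat.reduceAdd, pqNat_two, Nat.add_sub_cancel]
  field_simp

/-! ### The Seidel triangle -/

section SeidelFunctional

open Polynomial

variable (R : Type*) [CommRing R]

/-- The polynomial `∏_{j < m} (j (j + 1) - X (X + 1))`, in which the powers of `-X (X + 1)`, whose
moments are the median Genocchi numbers, are expanded. -/
noncomputable def centralPoly (m : ℕ) : R[X] :=
  ∏ j ∈ range m, ((j * (j + 1) : R[X]) - X * (X + 1))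

/-- The polynomial `∏_{1 ≤ j ≤ m} (j² - X²)`, which plays for the powers of `X²` the part of
`centralPoly` for those of `-X (X + 1)`. -/
noncomputable def squarePoly (m : ℕ) : R[X] :=
  ∏ j ∈ range m, ((j + 1 : R[X]) ^ 2 - X ^ 2)

lemma centralPoly_zero : centralPoly R 0 = 1 :=
  prod_range_zero _

lemma centralPoly_succ (m : ℕ) :
    centralPoly R (m + 1) = centralPoly R m * ((m * (m + 1) : R[X]) - X * (X + 1)) :=
  prod_range_succ _ _

lemma squarePoly_zero : squarePoly R 0 = 1 :=
  prod_range_zero _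

lemma squarePoly_succ (m : ℕ) :
    squarePoly R (m + 1) = squarePoly R m * ((m + 1 : R[X]) ^ 2 - X ^ 2) :=
  prod_range_succ _ _

lemma neg_X_mul_squarePoly (m : ℕ) :
    -X * squarePoly R m = centralPoly R m * ((m : R[X]) - X) := by
  induction m with
  | zero => simp [squarePoly_zero, centralPoly_zero]
  | succ m ih =>
    rw [squarePoly_succ, ← mul_assoc, ih, centralPoly_succ]
    push_cast
    ring

lemma degree_centralPoly [IsDomain R] (m : ℕ) : (centralPoly R m).degree = (2 * m : ℕ) := by
  have hfactor (j : ℕ) : ((j * (j + 1) : R[X]) - X * (X + 1)).degree = 2 := by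
    rw [show (j * (j + 1) : R[X]) - X * (X + 1) = C (-1) * X ^ 2 + C (-1) * X + C (j * (j + 1) : R)
      by simp only [map_neg, map_one, map_mul, map_add, map_natCast]; ring]
    exact degree_quadratic (neg_ne_zero.2 one_ne_zero)
  simp only [centralPoly, degree_prod, hfactor, sum_const, card_range, nsmul_eq_mul]
  rw [mul_comm, Nat.cast_mul, Nat.cast_ofNat]

/-- The polynomials `c_0, (X + 1) c_0, c_1, (X + 1) c_1, …` with `c_m = centralPoly R m`. Having one
polynomial in each degree, they form a basis over a field, on which a functional can be
prescribed. -/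
noncomputable def centralSequence [IsDomain R] : Polynomial.Sequence R where
  elems' i := if Even i then centralPoly R (i / 2) else (X + 1) * centralPoly R (i / 2)
  degree_eq' i := by
    rcases Nat.even_or_odd' i with ⟨k, rfl | rfl⟩
    · rw [if_pos (even_two_mul k), degree_centralPoly, Nat.mul_div_cancel_left k two_pos]
    · have hk : (2 * k + 1) / 2 = k := by omega
      have hX : (X + 1 : R[X]).degree = 1 := degree_X_add_C 1
      rw [if_neg (by simp), degree_mul, hX, degree_centralPoly, hk, add_comm]
      rfl

variable {R}

/-- A linear functional on polynomials whose values at the products `X ^ i * (X + 1) ^ j` are, up to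
sign, the entries of the Seidel triangle. -/
structure IsSeidelFunctional (φ : R[X] →ₗ[R] R) : Prop where
  apply_centralPoly (m : ℕ) : φ (centralPoly R m) = m.factorial * (m + 1).factorial
  apply_X_add_one_mul_centralPoly (m : ℕ) : φ ((X + 1) * centralPoly R m) = 0

lemma exists_isSeidelFunctional (K : Type*) [Field K] :
    ∃ φ : K[X] →ₗ[K] K, IsSeidelFunctional φ := by
  let B := (centralSequence K).basis fun i =>
    (leadingCoeff_ne_zero.2 ((centralSequence K).ne_zero i)).isUnit
  let value (i : ℕ) : K := if Even i then (i / 2).factorial * (i / 2 + 1).factorial else 0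
  have hB (i : ℕ) : B i =
      if Even i then centralPoly K (i / 2) else (X + 1) * centralPoly K (i / 2) := by
    rw [Polynomial.Sequence.basis_eq_self]
    rfl
  refine ⟨B.constr K value, fun m => ?_, fun m => ?_⟩
  · simpa [hB, value] using B.constr_basis K value (2 * m)
  · have hm : (2 * m + 1) / 2 = m := by omega
    simpa [hB, value, hm] using B.constr_basis K value (2 * m + 1)

namespace IsSeidelFunctional

variable {φ : R[X] →ₗ[R] R} (hφ : IsSeidelFunctional φ)
include hφ

lemma apply_one : φ 1 = 1 := by
  simpa [centralPoly_zero] using hφ.apply_centralPoly 0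

lemma apply_X_add_one_mul_pow_mul_centralPoly (n m : ℕ) :
    φ ((X + 1) * ((X * (X + 1)) ^ n * centralPoly R m)) = 0 := by
  induction n generalizing m with
  | zero => simpa using hφ.apply_X_add_one_mul_centralPoly m
  | succ n ih =>
    have hrec : (X + 1) * ((X * (X + 1)) ^ (n + 1) * centralPoly R m) =
        ((m : R) * (m + 1)) • ((X + 1) * ((X * (X + 1)) ^ n * centralPoly R m)) -
          (X + 1) * ((X * (X + 1)) ^ n * centralPoly R (m + 1)) := by
      simp only [centralPoly_succ, smul_eq_C_mul, map_mul, map_add, map_natCast, map_one]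
      ring
    rw [hrec, map_sub, map_smul, ih, ih, smul_zero, sub_zero]

lemma apply_X_mul_X_sub_one_mul_squarePoly (m : ℕ) :
    φ (X * (X - 1) * squarePoly R m) = 0 := by
  have hcentral : X * (X - 1) * squarePoly R m =
      (((m : R) + 1) * (m + 2)) • centralPoly R m - centralPoly R (m + 1) -
        ((m : R) + 2) • ((X + 1) * centralPoly R m) := by
    rw [show X * (X - 1) * squarePoly R m = -X * squarePoly R m * (1 - X) by ring,
      neg_X_mul_squarePoly, centralPoly_succ]
    simp only [smul_eq_C_mul, map_mul, map_add, map_one, map_natCast, map_ofNat]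
    ring
  rw [hcentral, map_sub, map_sub, map_smul, map_smul, hφ.apply_X_add_one_mul_centralPoly,
    hφ.apply_centralPoly, hφ.apply_centralPoly, Nat.factorial_succ (m + 1), Nat.factorial_succ m]
  push_cast
  simp only [smul_eq_mul]
  ring

lemma apply_X_mul_X_sub_one_mul_pow_mul_squarePoly (n m : ℕ) :
    φ (X * (X - 1) * ((X ^ 2) ^ n * squarePoly R m)) = 0 := by
  induction n generalizing m with
  | zero => simpa using hφ.apply_X_mul_X_sub_one_mul_squarePoly m
  | succ n ih =>
    have hrec : X * (X - 1) * ((X ^ 2) ^ (n + 1) * squarePoly R m) =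
        (((m : R) + 1) ^ 2) • (X * (X - 1) * ((X ^ 2) ^ n * squarePoly R m)) -
          X * (X - 1) * ((X ^ 2) ^ n * squarePoly R (m + 1)) := by
      simp only [squarePoly_succ, smul_eq_C_mul, map_pow, map_add, map_natCast, map_one]
      ring
    rw [hrec, map_sub, map_smul, ih, ih, smul_zero, sub_zero]

lemma apply_X_pow_succ_mul (n : ℕ) :
    φ (X ^ (n + 1) * (X + 1) ^ n) = -φ (X ^ n * (X + 1) ^ n) := by
  have h := hφ.apply_X_add_one_mul_pow_mul_centralPoly n 0
  rw [centralPoly_zero, mul_one, mul_pow, add_mul, one_mul, ← mul_assoc, ← pow_succ', map_add] at h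
  exact eq_neg_of_add_eq_zero_left h

lemma apply_X_pow_two_mul_add_two (n : ℕ) : φ (X ^ (2 * n + 2)) = φ (X ^ (2 * n + 1)) := by
  have h := hφ.apply_X_mul_X_sub_one_mul_pow_mul_squarePoly n 0
  have hpoly : X * (X - 1) * (X ^ 2) ^ n = X ^ (2 * n + 2) - (X ^ (2 * n + 1) : R[X]) := by
    ring
  rw [squarePoly_zero, mul_one, hpoly, map_sub] at h
  exact sub_eq_zero.1 h

end IsSeidelFunctional

end SeidelFunctional

section SeidelTriangle

open Polynomial

lemma seidelBack_eq_add {k j : ℕ} (u : ℕ → ℕ) (hj : j ≤ k) :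
    seidelBack k u j = u j + seidelBack k u (j + 1) := by
  rw [seidelBack, seidelBack, Icc_add_one_left_eq_Ioc, add_sum_Ioc_eq_sum_Icc hj]

lemma seidelBack_self (k : ℕ) (u : ℕ → ℕ) : seidelBack k u k = u k := by
  rw [seidelBack, Icc_self, sum_singleton]

lemma seidelOddRow_succ_zero (n : ℕ) :
    seidelOddRow (n + 1) 0 = seidelBack n (seidelOddRow n) 0 :=
  sum_range_one _

lemma seidelOddRow_succ_succ (n j : ℕ) :
    seidelOddRow (n + 1) (j + 1) =
      seidelOddRow (n + 1) j + seidelBack n (seidelOddRow n) (j + 1) :=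
  sum_range_succ _ _

lemma seidelOddRow_succ_self (n : ℕ) :
    seidelOddRow (n + 1) (n + 1) = seidelOddRow (n + 1) n := by
  rw [seidelOddRow_succ_succ, seidelBack, Icc_eq_empty (by simp), sum_empty, add_zero]

variable {R : Type*} [CommRing R] {φ : R[X] →ₗ[R] R} {n j k : ℕ}

namespace IsSeidelFunctional

lemma seidelOddRow_succ_eq (hφ : IsSeidelFunctional φ)
    (hback : ∀ j k, j + k = n →
      (seidelBack n (seidelOddRow n) j : R) = (-1) ^ n * φ (X ^ (n + j) * (X + 1) ^ k))
    (hjk : j + k = n) :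
    (seidelOddRow (n + 1) j : R) = (-1) ^ (n + 1) * φ (X ^ (n + 1 + j) * (X + 1) ^ k) := by
  induction j generalizing k with
  | zero =>
    obtain rfl : k = n := by omega
    rw [seidelOddRow_succ_zero, hback 0 k hjk, add_zero, add_zero, hφ.apply_X_pow_succ_mul]
    ring
  | succ j ih =>
    have hpoly : X ^ (n + 1 + (j + 1)) * (X + 1) ^ k =
        X ^ (n + 1 + j) * (X + 1) ^ (k + 1) - X ^ (n + (j + 1)) * (X + 1 : R[X]) ^ k := by
      ring
    rw [seidelOddRow_succ_succ, Nat.cast_add, ih (k := k + 1) (by omega), hback (j + 1) k hjk,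
      hpoly, map_sub]
    ring

lemma seidelBack_succ_eq (hφ : IsSeidelFunctional φ)
    (hodd : ∀ j k, j + k = n →
      (seidelOddRow (n + 1) j : R) = (-1) ^ (n + 1) * φ (X ^ (n + 1 + j) * (X + 1) ^ k))
    (hjk : j + k = n + 1) :
    (seidelBack (n + 1) (seidelOddRow (n + 1)) j : R) =
      (-1) ^ (n + 1) * φ (X ^ (n + 1 + j) * (X + 1) ^ k) := by
  induction k generalizing j with
  | zero =>
    obtain rfl : j = n + 1 := hjk
    rw [seidelBack_self, seidelOddRow_succ_self, hodd n 0 rfl, pow_zero, mul_one, mul_one,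
      show n + 1 + n = 2 * n + 1 by ring, show n + 1 + (n + 1) = 2 * n + 2 by ring,
      hφ.apply_X_pow_two_mul_add_two]
  | succ k ih =>
    have hpoly : X ^ (n + 1 + j) * (X + 1) ^ (k + 1) =
        X ^ (n + 1 + j) * (X + 1) ^ k + X ^ (n + 1 + (j + 1)) * (X + 1 : R[X]) ^ k := by
      ring
    rw [seidelBack_eq_add _ (by omega), Nat.cast_add, hodd j k (by omega), ih (by omega), hpoly,
      map_add]
    ring

lemma seidelBack_seidelOddRow_eq (hφ : IsSeidelFunctional φ) (hjk : j + k = n) :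
    (seidelBack n (seidelOddRow n) j : R) = (-1) ^ n * φ (X ^ (n + j) * (X + 1) ^ k) := by
  induction n generalizing j k with
  | zero =>
    obtain ⟨rfl, rfl⟩ := Nat.add_eq_zero_iff.1 hjk
    simp [seidelBack_self, seidelOddRow, hφ.apply_one]
  | succ n ih =>
    exact hφ.seidelBack_succ_eq
      (fun _ _ => hφ.seidelOddRow_succ_eq fun _ _ => ih) hjk

lemma medianGenocchi_eq (hφ : IsSeidelFunctional φ) (n : ℕ) :
    (medianGenocchi n : R) = φ ((-(X * (X + 1))) ^ n) := by
  rw [medianGenocchi, hφ.seidelBack_seidelOddRow_eq (zero_add n), add_zero, ← mul_pow,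
    neg_pow (X * (X + 1) : R[X]), ← smul_eq_mul, ← map_smul, smul_eq_C_mul, map_pow, map_neg,
    map_one]

end IsSeidelFunctional

end SeidelTriangle

section GenocchiMoments

open Polynomial

variable (R : Type*) [CommRing R]

/-- The total weight of the Motzkin paths with `n` steps from height `h` to height `0`, where
each step has twice the weight that the normalized E-permutations give it for `p = q = t = 1`. -/
def genocchiMotzkin (n h : ℕ) : R :=
  motzkin (fun h => 2 * (h + 1) ^ 2) (fun h => (h + 1) * (h + 2)) (fun h => (h + 1) * h) n h

lemma motzkinStep_choose (m h : ℕ) :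
    motzkinStep (R := R) (fun h => 2 * (h + 1) ^ 2) (fun h => (h + 1) * (h + 2))
      (fun h => (h + 1) * h) (fun h => m.choose h) h =
        (m + 1) * (m + 2) * (m + 1).choose h - m * (m + 1) * m.choose h := by
  have habsorb (k : ℕ) : (m.choose (k + 1) : R) * (k + 1) = m.choose k * (m - k) := by
    have h := congrArg (Nat.cast : ℕ → R) (Nat.add_one_mul_choose_eq m k)
    rw [Nat.choose_succ_succ'] at h
    push_cast at h
    linear_combination -h
  cases h with
  | zero =>
    simp only [motzkinStep, Nat.cast_zero, zero_add, one_pow, mul_one, Nat.choose_zero_right,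
      Nat.cast_one, one_mul, Nat.choose_one_right, mul_zero, zero_tsub, add_zero]
    ring
  | succ k =>
    simp only [motzkinStep, Nat.add_sub_cancel, Nat.choose_succ_succ', Nat.cast_add, Nat.cast_one]
    have h₁ := habsorb (k + 1)
    push_cast at h₁
    linear_combination (k + 3 : R) * h₁ + (m + k + 3 : R) * habsorb k

lemma sum_choose_mul_genocchiMotzkin_succ (n m : ℕ) :
    ∑ h ∈ range (m + 1), (m.choose h : R) * genocchiMotzkin R (n + 1) h =
      (m + 1) * (m + 2) * ∑ h ∈ range (m + 2), ((m + 1).choose h : R) * genocchiMotzkin R n h -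
        m * (m + 1) * ∑ h ∈ range (m + 1), (m.choose h : R) * genocchiMotzkin R n h := by
  have hextend : ∑ h ∈ range (m + 1), (m.choose h : R) * genocchiMotzkin R n h =
      ∑ h ∈ range (m + 2), (m.choose h : R) * genocchiMotzkin R n h := by
    rw [sum_range_succ _ (m + 1), Nat.choose_succ_self, Nat.cast_zero, zero_mul, add_zero]
  simp only [genocchiMotzkin, motzkin] at hextend ⊢
  rw [sum_mul_motzkinStep _ _ _ (fun h => by push_cast; ring) (by simp) _ _ fun h hh => by
    rw [Nat.choose_eq_zero_of_lt hh, Nat.cast_zero], hextend, mul_sum, mul_sum, ← sum_sub_distrib]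
  refine sum_congr rfl fun h _ => ?_
  rw [motzkinStep_choose]
  ring

variable {R}

lemma IsSeidelFunctional.apply_pow_mul_centralPoly {φ : R[X] →ₗ[R] R} (hφ : IsSeidelFunctional φ)
    (n m : ℕ) :
    φ ((-(X * (X + 1))) ^ n * centralPoly R m) =
      m.factorial * (m + 1).factorial *
        ∑ h ∈ range (m + 1), (m.choose h : R) * genocchiMotzkin R n h := by
  induction n generalizing m with
  | zero => simp [hφ.apply_centralPoly, genocchiMotzkin, motzkin]
  | succ n ih =>
    have hrec : (-(X * (X + 1))) ^ (n + 1) * centralPoly R m =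
        (-(X * (X + 1))) ^ n * centralPoly R (m + 1) -
          ((m : R) * (m + 1)) • ((-(X * (X + 1))) ^ n * centralPoly R m) := by
      simp only [centralPoly_succ, smul_eq_C_mul, map_mul, map_add, map_natCast, map_one]
      ring
    rw [hrec, map_sub, map_smul, ih, ih, sum_choose_mul_genocchiMotzkin_succ,
      Nat.factorial_succ (m + 1), Nat.factorial_succ m, smul_eq_mul]
    push_cast
    ring

lemma medianGenocchi_eq_genocchiMotzkin (K : Type*) [Field K] (n : ℕ) :
    (medianGenocchi n : K) = genocchiMotzkin K n 0 := by
  obtain ⟨φ, hφ⟩ := exists_isSeidelFunctional K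
  simpa [centralPoly_zero, hφ.medianGenocchi_eq] using hφ.apply_pow_mul_centralPoly n 0

lemma pqNat_one_one (n : ℕ) : pqNat (1 : R) 1 n = n := by
  simp [pqNat]

lemma card_normalizedEPerms (n : ℕ) :
    (#(normalizedEPerms n) : ℚ) = medianGenocchi n / 2 ^ n := by
  have hsum := sum_normalizedEPerms (1 : ℚ) 1 1 (by norm_num) n
  simp only [one_pow, mul_one, sum_const, nsmul_eq_mul, pqNat_one_one] at hsum
  rw [eq_div_iff (by positivity), mul_comm, hsum, medianGenocchi_eq_genocchiMotzkin,
    genocchiMotzkin, ← motzkin_const_mul]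
  congr 1 <;> ext h <;> push_cast <;> ring

end GenocchiMoments

end EvenOdd

theorem mainTheorem10 :
    (∀ (n : ℕ), ∀ σ ∈ EvenOdd.normalizedEPerms n,
      EvenOdd.des σ ≤ EvenOdd.res σ ∧ EvenOdd.des σ ≤ EvenOdd.les σ) ∧
    (∀ (K : Type*) [Field K] (p q t : K), p + q ≠ 0 →
      EvenOdd.HasJFraction
        (PowerSeries.mk fun n => ∑ σ ∈ EvenOdd.normalizedEPerms n,
          p ^ (EvenOdd.res σ - EvenOdd.des σ) * q ^ (EvenOdd.les σ - EvenOdd.des σ) *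
            t ^ EvenOdd.des σ)
        (fun n => EvenOdd.pqNat p q (n + 1) ^ 2)
        (fun n => EvenOdd.pqBinom p q (n + 1) 2 ^ 2 * t)) ∧
    (∀ n : ℕ, ((EvenOdd.normalizedEPerms n).card : ℚ) =
      (EvenOdd.medianGenocchi n : ℚ) / 2 ^ n) := by
  refine ⟨fun n σ hσ => ?_, fun K _ p q t hpq => ?_, EvenOdd.card_normalizedEPerms⟩
  · have h : EvenOdd.IsNormalized σ := (Finset.mem_filter.1 hσ).2
    exact ⟨h.des_le_res, h.des_le_les⟩
  · exact EvenOdd.hasJFraction_normalizedEPerms p q t hpq
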